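/- Let $M$ be a smooth Hausdorff manifold without boundary modelled on a real Banach space. For a smooth map $f$ write $Df$ for its tangent map. Let $T^0M=M$, $T^{i+1}M=T(T^iM)$, and let $\pi_i:T^{i+1}M\to T^iM$ be the tangent bundle projection. For a manifold $N$ let $\kappa_N:TTN\to TTN$ be the canonical involution, given in induced charts by $(x,y,X,Y)\mapsto(x,X,y,Y)$. A *semispray* on $N$ is a smooth vector field $S:TN\to TTN$ on $TN$ with $\kappa_N\circ S=S$; its *complete lift* is the vector field $S^c=D\kappa_N\circ\kappa_{TN}\circ DS\circ\kappa_N$ on $TTN$. A *geodesic* of $S$ is a smooth curve $\gamma:(-\epsilon,\epsilon)\to N$, $\epsilon>0$, with $\gamma''(t)=S(\gamma'(t))$ for all $t$. Let $T^\infty M=\varprojlim(T^iM,\pi_i)$, a Fréchet manifold whose charts are the limits of the charts of the $T^iM$ induced by a chart of $M$, with $TT^\infty M=\varprojlim (T(T^iM),D\pi_i)$ and $T^2T^\infty M=\varprojlim (T^2(T^iM),D^2\pi_i)$. Let $S$ be a semispray on $M$, put $S^{c_0}=S$ and $S^{c_{i+1}}=(S^{c_i})^c$ (a vector field on $T(T^iM)$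 for index $i$), and let $S^{c_\infty}=\varprojlim S^{c_i}:TT^\infty M\to T^2T^\infty M$. A geodesic of $S^{c_\infty}$ is a smooth curve $\gamma:(-\epsilon,\epsilon)\to T^\infty M$, $\epsilon>0$, with $\gamma''(t)=S^{c_\infty}(\gamma'(t))$ for all $t$. **Theorem.** Let $x=(x_i)_i\in T^\infty M$ and $\xi=(\xi_i)_i\in T_xT^\infty M$. Then there are $\epsilon>0$ and a geodesic $\gamma_\xi:(-\epsilon,\epsilon)\to T^\infty M$ of $S^{c_\infty}$ with $\gamma_\xi(0)=x$ and $\gamma_\xi'(0)=\xi$, and $\gamma_\xi=\varprojlim\gamma_{\xi_i}$, where, for every $i\ge 0$, $\gamma_{\xi_i}:(-\epsilon,\epsilon)\to T^iM$ is a geodesic of $S^{c_i}$ with $\gamma_{\xi_i}(0)=x_i$ and $\gamma_{\xi_i}'(0)=\xi_i$. The geodesic is unique: any two geodesics of $S^{c_\infty}$, defined on $(-\epsilon_1,\epsilon_1)$ and $(-\epsilon_2,\epsilon_2)$, with value $x$ and velocity $\xi$ at $0$ coincide on the intersection of these intervals. -/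

import Mathlib

open Set Filter
open scoped Manifold ContDiff Topology

universe u

noncomputable section

/-! ### The canonical flip, semisprays, complete lifts and geodesics on a Banach manifold -/

section Flip

variable {E H M : Type*} [NormedAddCommGroup E] [NormedSpace ℝ E] [TopologicalSpace H]
  (I : ModelWithCorners ℝ E H) [TopologicalSpace M] [ChartedSpace H M] [IsManifold I ∞ M]

/-- The canonical involution `κ : TTM → TTM`. A point of `TTM` is `⟨⟨x, y⟩, (X, Y)⟩`; Mathlib
expresses `y`, `X`, `Y` in the charts of `TM` and `TTM` induced by the preferred chart of `M` at
`x`, and in this chart the involution is `(x, y, X, Y) ↦ (x, X, y, Y)`. That the same formula holds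
in the charts induced by the other preferred charts is `extChartAt_canonicalFlip` below. -/
def canonicalFlip (z : TangentBundle I.tangent (TangentBundle I M)) :
    TangentBundle I.tangent (TangentBundle I M) :=
  let w : E × E := z.2
  ⟨⟨z.1.1, w.1⟩, ((z.1.2 : E), w.2)⟩

theorem canonicalFlip_canonicalFlip (z : TangentBundle I.tangent (TangentBundle I M)) :
    canonicalFlip I (canonicalFlip I z) = z := rfl

theorem tangentBundle_coordChange_eq [I.Boundaryless] (p0 p : TangentBundle I M) (hp : p.1 ∈ (extChartAt I p0.1).source) :
   (extChartAt I.tangent p0 ∘ (extChartAt I.tangent p).symm) =ᶠ[𝓝 (extChartAt I.tangent p p)]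
    fun q : E × E => ((extChartAt I p0.1 ∘ (extChartAt I p.1).symm) q.1,
     fderiv ℝ (extChartAt I p0.1 ∘ (extChartAt I p.1).symm) q.1 q.2) := by
  have h1 : ∀ᶠ q : E × E in 𝓝 (extChartAt I.tangent p p), q.1 ∈ (extChartAt I p.1).target :=
    continuous_fst.continuousAt.preimage_mem_nhds (extChartAt_target_mem_nhds (I := I) p.1)
  have h2 : ∀ᶠ e in 𝓝 (extChartAt I p.1 p.1), (extChartAt I p.1).symm e ∈ (extChartAt I p0.1).source :=
    (continuousAt_extChartAt_symm (I := I) p.1).preimage_mem_nhds (by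
      rw [extChartAt_to_inv]
      exact extChartAt_source_mem_nhds' hp)
  have h3 : ∀ᶠ q : E × E in 𝓝 (extChartAt I.tangent p p), (extChartAt I p.1).symm q.1 ∈ (extChartAt I p0.1).source :=
    (continuous_fst.tendsto (extChartAt I.tangent p p : E × E)).eventually h2
  filter_upwards [h1, h3] with q h1 h3
  refine Prod.ext rfl ?_
  have hs := (extChartAt I p.1).map_target h1
  have := tangentCoordChange_comp (I := I) (w := p.1) (x := (extChartAt I p.1).symm q.1) (y := p0.1)
    (z := (extChartAt I p.1).symm q.1) (v := q.2) ⟨⟨hs, mem_extChartAt_source _⟩, h3⟩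
  refine this.trans ?_
  rw [tangentCoordChange_def, I.range_eq_univ, fderivWithin_univ, (extChartAt I p.1).right_inv h1]

theorem extChartAt_tangent_tangent_apply [I.Boundaryless] (z0 z : TangentBundle I.tangent (TangentBundle I M))
    (hp : z.1.1 ∈ (extChartAt I z0.1.1).source) (τ : E → E) (e v : E) (w : E × E)
    (h_τ : τ = extChartAt I z0.1.1 ∘ (extChartAt I z.1.1).symm)
    (he : e = extChartAt I z.1.1 z.1.1) (hv : v = z.1.2) (hw : w = z.2) :
    extChartAt I.tangent.tangent z0 z = ((extChartAt I z0.1.1 z.1.1, fderiv ℝ τ e v),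
      (fderiv ℝ τ e w.1, fderiv ℝ (fderiv ℝ τ) e w.1 v + fderiv ℝ τ e w.2)) := by
  have hτ : ContDiffAt ℝ ∞ τ e := by
    have := contDiffWithinAt_ext_coord_change (I := I) (n := ∞) z0.1.1 z.1.1 (y := e) (by
      rw [PartialEquiv.trans_source'', PartialEquiv.symm_symm, PartialEquiv.symm_target, he]
      exact mem_image_of_mem _ ⟨mem_extChartAt_source _, hp⟩)
    rwa [I.range_eq_univ, contDiffWithinAt_univ, ← h_τ] at this
  have hτ' : DifferentiableAt ℝ (fderiv ℝ τ) e :=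
    (hτ.fderiv_right (m := 1) (by norm_cast)).differentiableAt one_ne_zero
  have h1 : tangentCoordChange I z.1.1 z0.1.1 z.1.1 = fderiv ℝ τ e := by
    rw [tangentCoordChange_def, I.range_eq_univ, fderivWithin_univ, h_τ, he]
  have h2 : tangentCoordChange I.tangent z.1 z0.1 z.1 =
      fderiv ℝ (fun q : E × E => (τ q.1, fderiv ℝ τ q.1 q.2)) (e, v) := by
    rw [tangentCoordChange_def, I.tangent.range_eq_univ, fderivWithin_univ]
    have hp' : extChartAt I.tangent z.1 z.1 = (e, v) := by
      rw [he, hv]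
      exact Prod.ext rfl (tangentCoordChange_self (I := I) (mem_extChartAt_source _))
    rw [(tangentBundle_coordChange_eq I z0.1 z.1 hp).fderiv_eq, hp', h_τ]
  have h3 : HasFDerivAt (fun q : E × E => (τ q.1, fderiv ℝ τ q.1 q.2))
      (((fderiv ℝ τ e).comp (ContinuousLinearMap.fst ℝ E E)).prod
        ((fderiv ℝ τ e).comp (ContinuousLinearMap.snd ℝ E E) +
          ((fderiv ℝ (fderiv ℝ τ) e).comp (ContinuousLinearMap.fst ℝ E E)).flip v)) (e, v) := by
    refine HasFDerivAt.prodMk ?_ ?_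
    · exact (hτ.differentiableAt (by simp)).hasFDerivAt.comp (e, v)
        (hasFDerivAt_fst (𝕜 := ℝ) (p := (e, v)))
    · exact (hτ'.hasFDerivAt.comp (e, v) (hasFDerivAt_fst (𝕜 := ℝ) (p := (e, v)))).clm_apply
        (hasFDerivAt_snd (𝕜 := ℝ) (p := (e, v)))
  have h4 : tangentCoordChange I.tangent z.1 z0.1 z.1 w =
      (fderiv ℝ τ e w.1, fderiv ℝ (fderiv ℝ τ) e w.1 v + fderiv ℝ τ e w.2) := by
    rw [h2, h3.fderiv]
    simp [add_comm, ContinuousLinearMap.flip_apply]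
  subst hv hw
  exact Prod.ext (Prod.ext rfl (congrArg (fun L : E →L[ℝ] E => L z.1.2) h1)) h4

/-- In the chart of `TTM` induced by any preferred chart of `M`, the flip is
`(x, y, X, Y) ↦ (x, X, y, Y)`. -/
theorem extChartAt_canonicalFlip [I.Boundaryless] (z0 z : TangentBundle I.tangent (TangentBundle I M))
    (hp : z.1.1 ∈ (extChartAt I z0.1.1).source) :
    extChartAt I.tangent.tangent (canonicalFlip I z0) (canonicalFlip I z) =
      (((extChartAt I.tangent.tangent z0 z).1.1, (extChartAt I.tangent.tangent z0 z).2.1),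
        ((extChartAt I.tangent.tangent z0 z).1.2, (extChartAt I.tangent.tangent z0 z).2.2)) := by
  obtain ⟨τ, h_τ⟩ : ∃ τ, τ = extChartAt I z0.1.1 ∘ (extChartAt I z.1.1).symm := ⟨_, rfl⟩
  obtain ⟨e, he⟩ : ∃ e, e = extChartAt I z.1.1 z.1.1 := ⟨_, rfl⟩
  obtain ⟨v, hv⟩ : ∃ v : E, v = z.1.2 := ⟨_, rfl⟩
  obtain ⟨w, hw⟩ : ∃ w : E × E, w = z.2 := ⟨_, rfl⟩
  have hτ : ContDiffAt ℝ ∞ τ e := by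
    have := contDiffWithinAt_ext_coord_change (I := I) (n := ∞) z0.1.1 z.1.1 (y := e) (by
      rw [PartialEquiv.trans_source'', PartialEquiv.symm_symm, PartialEquiv.symm_target, he]
      exact mem_image_of_mem _ ⟨mem_extChartAt_source _, hp⟩)
    rwa [I.range_eq_univ, contDiffWithinAt_univ, ← h_τ] at this
  have hsymm := (hτ.isSymmSndFDerivAt (by simp; norm_cast)).eq
  have hw1 : w.1 = (canonicalFlip I z).1.2 := by rw [hw]; rfl
  have hw2 : (v, w.2) = (canonicalFlip I z).2 := by rw [hw, hv]; rfl
  rw [extChartAt_tangent_tangent_apply I z0 z hp τ e v w h_τ he hv hw,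
    extChartAt_tangent_tangent_apply I (canonicalFlip I z0) (canonicalFlip I z) hp τ e w.1 (v, w.2) h_τ he hw1 hw2]
  simp only
  rw [hsymm v w.1]
  rfl

theorem contMDiff_canonicalFlip [I.Boundaryless] : ContMDiff I.tangent.tangent I.tangent.tangent ∞
   (canonicalFlip I (M := M)) := by
  intro z0
  let sw : (E × E) × (E × E) →L[ℝ] (E × E) × (E × E) :=
    (((ContinuousLinearMap.fst ℝ E E).comp (ContinuousLinearMap.fst ℝ _ _)).prod 
      ((ContinuousLinearMap.fst ℝ E E).comp (ContinuousLinearMap.snd ℝ _ _))).prod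
    (((ContinuousLinearMap.snd ℝ E E).comp (ContinuousLinearMap.fst ℝ _ _)).prod 
      ((ContinuousLinearMap.snd ℝ E E).comp (ContinuousLinearMap.snd ℝ _ _)))
  have hev : canonicalFlip I =ᶠ[𝓝 z0] fun z => (extChartAt I.tangent.tangent (canonicalFlip I z0)).symm
      (sw (extChartAt I.tangent.tangent z0 z)) := by
    filter_upwards [extChartAt_source_mem_nhds (I := I.tangent.tangent) z0] with z hz
    have hz' : z.1.1 ∈ (extChartAt I z0.1.1).source := by
      rw [extChartAt_source] at hz ⊢
      rwa [TangentBundle.mem_chart_source_iff, TangentBundle.mem_chart_source_iff] at hz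
    have := extChartAt_canonicalFlip I z0 z hz'
    change _ = (extChartAt I.tangent.tangent (canonicalFlip I z0)).symm (((extChartAt I.tangent.tangent z0 z).1.1, (extChartAt I.tangent.tangent z0 z).2.1), ((extChartAt I.tangent.tangent z0 z).1.2, (extChartAt I.tangent.tangent z0 z).2.2))
    rw [← this, PartialEquiv.left_inv]
    rw [extChartAt_source, TangentBundle.mem_chart_source_iff, TangentBundle.mem_chart_source_iff]
    rwa [extChartAt_source] at hz'
  refine ContMDiffAt.congr_of_eventuallyEq ?_ hev
  have h0 : sw (extChartAt I.tangent.tangent z0 z0) = extChartAt I.tangent.tangent (canonicalFlip I z0) (canonicalFlip I z0) :=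
    (extChartAt_canonicalFlip I z0 z0 (mem_extChartAt_source _)).symm
  have h1 := (contMDiffOn_extChartAt_symm (I := I.tangent.tangent) (n := ∞) (canonicalFlip I z0)).contMDiffAt
    (extChartAt_target_mem_nhds (canonicalFlip I z0))
  rw [← h0] at h1
  exact h1.comp z0 (sw.contMDiff.contMDiffAt.comp z0 contMDiffAt_extChartAt)


theorem contMDiff_tangentBundle_proj :
    ContMDiff I.tangent I ∞ (Bundle.TotalSpace.proj : TangentBundle I M → M) :=
  Bundle.contMDiff_proj (n := ∞) (TangentSpace I : M → Type _)

/-- `Tπ = π_{TM} ∘ κ`. -/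
theorem tangentMap_base [I.Boundaryless] (z : TangentBundle I.tangent (TangentBundle I M)) :
    tangentMap I.tangent I (Bundle.TotalSpace.proj : TangentBundle I M → M) z =
      (canonicalFlip I z).1 := by
  have hd : MDifferentiableAt I.tangent I (Bundle.TotalSpace.proj : TangentBundle I M → M) z.1 :=
    (Bundle.contMDiff_proj (n := ∞) (TangentSpace I : M → Type _)).mdifferentiableAt (by simp)
  have h : mfderiv I.tangent I (Bundle.TotalSpace.proj : TangentBundle I M → M) z.1 =
      ContinuousLinearMap.fst ℝ E E := by
    rw [hd.mfderiv, I.tangent.range_eq_univ, fderivWithin_univ]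
    have hev : writtenInExtChartAt I.tangent I z.1 (Bundle.TotalSpace.proj : TangentBundle I M → M)
        =ᶠ[𝓝 (extChartAt I.tangent z.1 z.1)] (Prod.fst : E × E → E) := by
      filter_upwards [continuous_fst.continuousAt.preimage_mem_nhds
        (extChartAt_target_mem_nhds (I := I) z.1.1)] with q hq
      exact (extChartAt I z.1.1).right_inv hq
    rw [hev.fderiv_eq]
    exact fderiv_fst
  have h' : mfderiv I.tangent I (Bundle.TotalSpace.proj : TangentBundle I M → M) z.1 z.2 =
      (canonicalFlip I z).1.2 := by
    rw [h]; rfl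
  exact congrArg (Bundle.TotalSpace.mk (F := E) z.1.1) h'

/-- The complete lift `S^c = Tκ ∘ κ ∘ TS ∘ κ : TTM → TTTM` of a vector field `S : TM → TTM` on `TM`. -/
def completeLift (S : TangentBundle I M → TangentBundle I.tangent (TangentBundle I M)) :
    TangentBundle I.tangent (TangentBundle I M) →
      TangentBundle I.tangent.tangent (TangentBundle I.tangent (TangentBundle I M)) :=
  tangentMap I.tangent.tangent I.tangent.tangent (canonicalFlip I (M := M)) ∘
    canonicalFlip I.tangent (M := TangentBundle I M) ∘
    tangentMap I.tangent I.tangent.tangent S ∘ canonicalFlip I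

/-- `TTπ ∘ S^c = S ∘ Tπ`, where `π : TM → M`. -/
theorem tangentMap_tangentMap_completeLift [I.Boundaryless] (S : TangentBundle I M → TangentBundle I.tangent (TangentBundle I M))
   (z : TangentBundle I.tangent (TangentBundle I M)) :
    tangentMap I.tangent.tangent I.tangent
      (tangentMap I.tangent I (Bundle.TotalSpace.proj : TangentBundle I M → M))
      (completeLift I S z) =
    S (tangentMap I.tangent I (Bundle.TotalSpace.proj : TangentBundle I M → M) z) := by
  have h1 : tangentMap I.tangent I (Bundle.TotalSpace.proj : TangentBundle I M → M) =
    (Bundle.TotalSpace.proj : TangentBundle I.tangent (TangentBundle I M) → TangentBundle I M) ∘ canonicalFlip I :=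
    funext (tangentMap_base I)
  have hp : ContMDiff I.tangent.tangent I.tangent ∞ (Bundle.TotalSpace.proj : TangentBundle I.tangent (TangentBundle I M) → TangentBundle I M) :=
    Bundle.contMDiff_proj (n := ∞) (TangentSpace I.tangent : TangentBundle I M → Type _)
  have hk := (contMDiff_canonicalFlip I (M := M)).mdifferentiable (by simp)
  have h2 : tangentMap I.tangent.tangent I.tangent.tangent (canonicalFlip I (M := M)) ∘
     tangentMap I.tangent.tangent I.tangent.tangent (canonicalFlip I (M := M)) = id := by
    rw [← tangentMap_comp hk hk]
    exact tangentMap_id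
  rw [h1, tangentMap_comp (hp.mdifferentiable (by simp)) hk]
  change tangentMap I.tangent.tangent I.tangent _ ((tangentMap I.tangent.tangent I.tangent.tangent (canonicalFlip I (M := M)) ∘
     tangentMap I.tangent.tangent I.tangent.tangent (canonicalFlip I (M := M))) _) = _
  rw [h2]
  exact tangentMap_base I.tangent _

/-- A semispray on `M`: a smooth vector field `S` on `TM` with `κ ∘ S = S`. -/
structure IsSemispray (S : TangentBundle I M → TangentBundle I.tangent (TangentBundle I M)) :
    Prop where
  contMDiff : ContMDiff I.tangent I.tangent.tangent ∞ S
  proj : ∀ v, (S v).proj = v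
  flip : ∀ v, canonicalFlip I (S v) = S v

/-- The canonical lift `t ↦ γ'(t) ∈ TM` of a curve `γ` in `M`. -/
def curveLift (γ : ℝ → M) (t : ℝ) : TangentBundle I M :=
  tangentMap 𝓘(ℝ, ℝ) I γ ⟨t, (1 : ℝ)⟩

/-- `γ : (-ε, ε) → M` is a geodesic of `S`: it is smooth and `γ''(t) = S(γ'(t))`. -/
structure IsGeodesic (S : TangentBundle I M → TangentBundle I.tangent (TangentBundle I M))
    (ε : ℝ) (γ : ℝ → M) : Prop where
  contMDiffOn : ContMDiffOn 𝓘(ℝ, ℝ) I ∞ γ (Ioo (-ε) ε)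
  curveLift_curveLift : ∀ t ∈ Ioo (-ε) ε,
    curveLift I.tangent (curveLift I γ) t = S (curveLift I γ t)

end Flip

/-! ### Banach manifolds and their iterated tangent bundles -/

/-- A smooth manifold without boundary, modelled on a real Banach space. -/
structure BanachManifold where
  E : Type u
  H : Type u
  carrier : Type u
  [normedAddCommGroup : NormedAddCommGroup E]
  [normedSpace : NormedSpace ℝ E]
  [completeSpace : CompleteSpace E]
  [topologicalSpaceH : TopologicalSpace H]
  I : ModelWithCorners ℝ E H
  [boundaryless : I.Boundaryless]
  [topologicalSpace : TopologicalSpace carrier]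
  [chartedSpace : ChartedSpace H carrier]
  [isManifold : IsManifold I ∞ carrier]

namespace BanachManifold

instance : CoeSort BanachManifold.{u} (Type u) := ⟨carrier⟩

attribute [instance] normedAddCommGroup normedSpace completeSpace topologicalSpaceH boundaryless
  topologicalSpace chartedSpace isManifold

/-- The tangent bundle `TM`. -/
abbrev tangent (M : BanachManifold.{u}) : BanachManifold.{u} where
  E := M.E × M.E
  H := ModelProd M.H M.E
  carrier := TangentBundle M.I M
  I := M.I.tangent

/-- The iterated tangent bundle `T^i M`. -/
def iterTangent (M : BanachManifold.{u}) : ℕ → BanachManifold.{u}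
  | 0 => M
  | i + 1 => (M.iterTangent i).tangent

/-- The iterated complete lift `S^{c_i}`, a vector field on `T(T^i M)`; here `S^{c_0} = S`. -/
def iterLift (M : BanachManifold.{u}) (S : M.tangent → M.tangent.tangent) :
    ∀ i, (M.iterTangent i).tangent → (M.iterTangent i).tangent.tangent
  | 0 => S
  | i + 1 => completeLift (M.iterTangent i).I (M.iterLift S i)

end BanachManifold

/-! ### Projective limits of Banach manifolds -/

/-- A projective system of Banach manifolds `X 0 ← X 1 ← X 2 ← ⋯` over a projective system of model
spaces, in which the preferred charts at the entries of a point of the limit form a projective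
family, whose limit has an open domain. -/
structure ProjSystem where
  X : ℕ → BanachManifold.{u}
  map : ∀ i, X (i + 1) → X i
  modelMap : ∀ i, (X (i + 1)).E →L[ℝ] (X i).E
  contMDiff_map : ∀ i, ContMDiff (X (i + 1)).I (X i).I ∞ (map i)
  mem_source_iff : ∀ i x y, y ∈ (extChartAt (X (i + 1)).I x).source ↔
    map i y ∈ (extChartAt (X i).I (map i x)).source
  chart_map : ∀ i x y, y ∈ (extChartAt (X (i + 1)).I x).source →
    extChartAt (X i).I (map i x) (map i y) = modelMap i (extChartAt (X (i + 1)).I x y)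

namespace ProjSystem

/-- In the preferred charts, the derivative of a connecting map is the connecting map of the
model spaces. -/
theorem mfderiv_map (P : ProjSystem.{u}) (i : ℕ) (y : P.X (i + 1)) :
    mfderiv (P.X (i + 1)).I (P.X i).I (P.map i) y = P.modelMap i := by
  have hd : MDifferentiableAt (P.X (i + 1)).I (P.X i).I (P.map i) y :=
    (P.contMDiff_map i).mdifferentiable (by simp) y
  rw [hd.mfderiv, ModelWithCorners.range_eq_univ, fderivWithin_univ]
  have hev : writtenInExtChartAt (P.X (i + 1)).I (P.X i).I y (P.map i)
      =ᶠ[𝓝 (extChartAt (P.X (i + 1)).I y y)] P.modelMap i := by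
    filter_upwards [extChartAt_target_mem_nhds (I := (P.X (i + 1)).I) y] with q hq
    have := P.chart_map i y _ ((extChartAt (P.X (i + 1)).I y).map_target hq)
    rw [(extChartAt (P.X (i + 1)).I y).right_inv hq] at this
    exact this
  rw [hev.fderiv_eq]
  exact (P.modelMap i).fderiv

/-- The connecting maps of the model spaces commute with coordinate changes on tangent spaces. -/
theorem tangentCoordChange_map (P : ProjSystem.{u}) (i : ℕ) (x y : P.X (i + 1))
    (h : y ∈ (extChartAt (P.X (i + 1)).I x).source) (v : (P.X (i + 1)).E) :
    tangentCoordChange (P.X i).I (P.map i y) (P.map i x) (P.map i y) (P.modelMap i v) =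
      P.modelMap i (tangentCoordChange (P.X (i + 1)).I y x y v) := by
  have h' := (P.mem_source_iff i x y).1 h
  have h1 := hasFDerivWithinAt_tangentCoordChange (I := (P.X (i + 1)).I)
    ⟨mem_extChartAt_source (I := (P.X (i + 1)).I) y, h⟩
  have h2 := hasFDerivWithinAt_tangentCoordChange (I := (P.X i).I)
    ⟨mem_extChartAt_source (I := (P.X i).I) (P.map i y), h'⟩
  rw [ModelWithCorners.range_eq_univ, hasFDerivWithinAt_univ] at h1 h2
  rw [P.chart_map i y y (mem_extChartAt_source y)] at h2
  have h3 := (P.modelMap i).hasFDerivAt.comp _ h1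
  have h4 := h2.comp _ (P.modelMap i).hasFDerivAt
  have hev : ((extChartAt (P.X i).I (P.map i x) ∘ (extChartAt (P.X i).I (P.map i y)).symm) ∘
        P.modelMap i) =ᶠ[𝓝 (extChartAt (P.X (i + 1)).I y y)]
      (P.modelMap i ∘ (extChartAt (P.X (i + 1)).I x ∘ (extChartAt (P.X (i + 1)).I y).symm)) := by
    have hx : ∀ᶠ q in 𝓝 (extChartAt (P.X (i + 1)).I y y),
        (extChartAt (P.X (i + 1)).I y).symm q ∈ (extChartAt (P.X (i + 1)).I x).source :=
      (continuousAt_extChartAt_symm y).preimage_mem_nhds (by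
        rw [extChartAt_to_inv]
        exact extChartAt_source_mem_nhds' h)
    filter_upwards [extChartAt_target_mem_nhds (I := (P.X (i + 1)).I) y, hx] with q hq hq'
    have hs := (extChartAt (P.X (i + 1)).I y).map_target hq
    have e1 := P.chart_map i y _ hs
    rw [(extChartAt (P.X (i + 1)).I y).right_inv hq] at e1
    have e2 := P.chart_map i x _ hq'
    simp only [Function.comp_apply]
    rw [← e1, (extChartAt (P.X i).I (P.map i y)).left_inv ((P.mem_source_iff i y _).1 hs), e2]
  exact DFunLike.congr_fun (h4.unique (h3.congr_of_eventuallyEq hev)) v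

/-- The system of the tangent bundles `T(X i)` with the connecting maps `T(map i)`. -/
abbrev tangent (P : ProjSystem.{u}) : ProjSystem.{u} where
  X i := (P.X i).tangent
  map i := tangentMap (P.X (i + 1)).I (P.X i).I (P.map i)
  modelMap i := (P.modelMap i).prodMap (P.modelMap i)
  contMDiff_map i := (P.contMDiff_map i).contMDiff_tangentMap (by simp)
  mem_source_iff i x y := by
    have := P.mem_source_iff i x.1 y.1
    simp only [extChartAt_source, TangentBundle.mem_chart_source_iff] at this ⊢
    exact this
  chart_map i x y h := by
    have h' : y.1 ∈ (extChartAt (P.X (i + 1)).I x.1).source := by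
      simp only [extChartAt_source, TangentBundle.mem_chart_source_iff] at h ⊢
      exact h
    refine Prod.ext (P.chart_map i x.1 y.1 h') ?_
    refine Eq.trans ?_ (P.tangentCoordChange_map i x.1 y.1 h' y.2)
    exact congrArg (fun L : (P.X (i + 1)).E →L[ℝ] (P.X i).E =>
      tangentCoordChange (P.X i).I (P.map i y.1) (P.map i x.1) (P.map i y.1) (L y.2))
      (P.mfderiv_map i y.1)

/-- The projective limit of the system, with the topology induced by the product. -/
abbrev Lim (P : ProjSystem.{u}) : Type u :=
  {x : ∀ i, P.X i // ∀ i, P.map i (x (i + 1)) = x i}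

/-- The Fréchet space on which the projective limit is modelled: the projective limit of the model
spaces, with the topology induced by the product. -/
def model (P : ProjSystem.{u}) : Submodule ℝ (∀ i, (P.X i).E) where
  carrier := {e | ∀ i, P.modelMap i (e (i + 1)) = e i}
  add_mem' ha hb i := by
    simp only [Pi.add_apply, map_add]
    rw [ha i, hb i]
  zero_mem' i := by simp
  smul_mem' c a ha i := by
    simp only [Pi.smul_apply, map_smul]
    rw [ha i]

open Classical in
/-- The chart of the projective limit around `x`: the limit of the preferred charts at the `x i`
(with junk value `0` outside the domain of the chart). -/
def chart (P : ProjSystem.{u}) (x y : P.Lim) : P.model :=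
  if h : ∀ i, y.1 i ∈ (extChartAt (P.X i).I (x.1 i)).source then
    ⟨fun i => extChartAt (P.X i).I (x.1 i) (y.1 i), fun i => by
      have := P.chart_map i (x.1 (i + 1)) (y.1 (i + 1)) (h (i + 1))
      rw [x.2 i, y.2 i] at this
      exact this.symm⟩
  else 0

/-- The projection of the tangent bundle `lim T(X i)` of the projective limit. -/
def tangentProj (P : ProjSystem.{u}) (ξ : P.tangent.Lim) : P.Lim :=
  ⟨fun i => (ξ.1 i).1, fun i => congrArg Bundle.TotalSpace.proj (ξ.2 i)⟩

/-- The coordinates of the tangent vector `ξ` in the chart around its base point. -/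
def tangentCoord (P : ProjSystem.{u}) (ξ : P.tangent.Lim) : P.model :=
  ⟨fun i => ((ξ.1 i).2 : (P.X i).E), fun i => by
    have h := congrArg (fun z : TangentBundle (P.X i).I (P.X i) => (z.2 : (P.X i).E)) (ξ.2 i)
    refine Eq.trans ?_ h
    exact congrArg (fun L : (P.X (i + 1)).E →L[ℝ] (P.X i).E => L (ξ.1 (i + 1)).2)
      (P.mfderiv_map i (ξ.1 (i + 1)).1).symm⟩

/-- The curve `γ` in the projective limit is differentiable at `t` and `γ'(t) = ξ`. -/
def HasVelocityAt (P : ProjSystem.{u}) (γ : ℝ → P.Lim) (ξ : P.tangent.Lim) (t : ℝ) : Prop :=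
  P.tangentProj ξ = γ t ∧ ContinuousAt γ t ∧
    HasDerivAt (fun s => P.chart (γ t) (γ s)) (P.tangentCoord ξ) t

/-- The curve `γ` in the projective limit is smooth near `t`: it is continuous at `t` and, in the
chart around `γ t`, it has derivatives of all orders near `t`. -/
def SmoothCurveAt (P : ProjSystem.{u}) (γ : ℝ → P.Lim) (t : ℝ) : Prop :=
  ContinuousAt γ t ∧ ∃ d : ℕ → ℝ → P.model, d 0 = (fun s => P.chart (γ t) (γ s)) ∧
    ∀ᶠ s in 𝓝 t, ∀ n, HasDerivAt (d n) (d (n + 1) s) s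

/-- The curve `γ : (-ε, ε) → lim X i` is a geodesic of the vector field `S` on the tangent bundle of
the projective limit: it is smooth and `γ''(t) = S(γ'(t))`. -/
structure IsGeodesic (P : ProjSystem.{u}) (S : P.tangent.Lim → P.tangent.tangent.Lim)
    (ε : ℝ) (γ : ℝ → P.Lim) : Prop where
  smooth : ∀ t ∈ Ioo (-ε) ε, P.SmoothCurveAt γ t
  hasVelocityAt : ∃ γ' : ℝ → P.tangent.Lim, ∀ t ∈ Ioo (-ε) ε,
    P.HasVelocityAt γ (γ' t) t ∧ P.tangent.HasVelocityAt γ' (S (γ' t)) t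

end ProjSystem

/-! ### The infinite order iterated tangent bundle -/

namespace BanachManifold

/-- The projective system `M ← TM ← T²M ← ⋯` of the tangent bundle projections. Its limit is
`T^∞ M`. -/
abbrev infTangent (M : BanachManifold.{u}) : ProjSystem.{u} where
  X := M.iterTangent
  map i := (Bundle.TotalSpace.proj : TangentBundle (M.iterTangent i).I (M.iterTangent i) → _)
  modelMap i := ContinuousLinearMap.fst ℝ (M.iterTangent i).E (M.iterTangent i).E
  contMDiff_map i := contMDiff_tangentBundle_proj (M.iterTangent i).I
  mem_source_iff i x y := by
    rw [extChartAt_source, extChartAt_source]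
    exact TangentBundle.mem_chart_source_iff (I := (M.iterTangent i).I) y x
  chart_map i x y _ := rfl

/-- The lift `S^{c_∞} = lim S^{c_i}` of `S : TM → TTM` to `T^∞ M`. -/
def infLift (M : BanachManifold.{u}) (S : M.tangent → M.tangent.tangent)
    (ξ : M.infTangent.tangent.Lim) : M.infTangent.tangent.tangent.Lim :=
  ⟨fun i => M.iterLift S i (ξ.1 i), fun i =>
    (tangentMap_tangentMap_completeLift (M.iterTangent i).I (M.iterLift S i) (ξ.1 (i + 1))).trans
      (congrArg (M.iterLift S i) (ξ.2 i))⟩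

end BanachManifold

end

/-! The limit `T^∞ M` is modelled on a Fréchet space, where differential equations need not be
solvable; the equation is therefore solved on each Banach manifold `T^i M`, and the danger is that
the interval of existence shrinks to a point as `i` grows. It does not, because the lifted equations
are linear in the new variables.

In a chart a semispray is an equation `x'' = f(x, x')`. By `hasLocalForm_completeLift`, its complete
lift is the same equation for `x` together with `y'' = Df(x, x')(y, y')`, the linearization along
`x`. So a geodesic one level up is a geodesic with a Jacobi field along it. A linear equation with
continuous coefficients is solvable on the whole of a compact interval
(`exists_solution_linearODE`), hence every initial vector over that of a given solution has a lift
on the same `[-ε, ε]` (`IsLocalGeodesic.exists_lift`). The number `ε` is fixed at level `0`, and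
`exists_chart_geodesics` builds the tower by dependent choice, each curve projecting to the one
below.

Continuity, velocity and smoothness of a curve in the limit are tested on components
(`ProjSystem.hasVelocityAt_iff`, `ProjSystem.smoothCurveAt_of_contMDiffOn`), so the tower is a
geodesic of `S^{c_∞}`. Uniqueness is also componentwise: velocities of geodesics are integral curves
of a smooth field on the Hausdorff manifold `T(T^i M)` (`IsSmoothField.eqOn_of_curveLift_eq`). -/

noncomputable section

/-! ### Linear differential equations -/

section LinearODE

variable {E : Type*} [NormedAddCommGroup E] [NormedSpace ℝ E]

/-- The radial retraction of a normed space onto the closed ball of radius `R`. -/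
def radialRetraction (R : ℝ) (x : E) : E := (R / max R ‖x‖) • x

theorem radialRetraction_of_norm_le {R : ℝ} (hR : 0 < R) {x : E} (hx : ‖x‖ ≤ R) :
    radialRetraction R x = x := by
  rw [radialRetraction, max_eq_left hx, div_self hR.ne', one_smul]

theorem norm_radialRetraction_le {R : ℝ} (hR : 0 < R) (x : E) : ‖radialRetraction R x‖ ≤ R := by
  have hm : 0 < max R ‖x‖ := lt_max_of_lt_left hR
  rw [radialRetraction, norm_smul, Real.norm_of_nonneg (by positivity), div_mul_eq_mul_div,
    div_le_iff₀ hm]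
  gcongr
  exact le_max_right _ _

theorem norm_radialRetraction_le_norm {R : ℝ} (hR : 0 < R) (x : E) :
    ‖radialRetraction R x‖ ≤ ‖x‖ := by
  have hm : 0 < max R ‖x‖ := lt_max_of_lt_left hR
  rw [radialRetraction, norm_smul, Real.norm_of_nonneg (by positivity)]
  exact mul_le_of_le_one_left (norm_nonneg _) ((div_le_one hm).2 (le_max_left _ _))

/-- The difference of two values is a rescaled `x - y` plus a multiple of `y` coming from the change
of the scaling factor. Each has norm at most `‖x - y‖`, whence the constant `2`, valid in any normed
space. -/
theorem lipschitzWith_radialRetraction {R : ℝ} (hR : 0 < R) :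
    LipschitzWith 2 (radialRetraction R : E → E) := by
  refine LipschitzWith.of_dist_le_mul fun x y => ?_
  rw [dist_eq_norm, dist_eq_norm]
  have hx : 0 < max R ‖x‖ := lt_max_of_lt_left hR
  have hy : 0 < max R ‖y‖ := lt_max_of_lt_left hR
  have e : radialRetraction R x - radialRetraction R y =
      (R / max R ‖x‖) • (x - y) + (R / max R ‖x‖ * ((max R ‖y‖ - max R ‖x‖) / max R ‖y‖)) • y := by
    rw [radialRetraction, radialRetraction, smul_sub, sub_add, ← sub_smul]
    congr 2
    field_simp
    ring
  have h1 : R / max R ‖x‖ ≤ 1 := (div_le_one hx).2 (le_max_left _ _)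
  have h0 : 0 ≤ R / max R ‖x‖ := by positivity
  have h2 : |max R ‖y‖ - max R ‖x‖| ≤ ‖x - y‖ := by
    refine (abs_max_sub_max_le_max R ‖y‖ R ‖x‖).trans ?_
    rw [sub_self, abs_zero, max_eq_right (abs_nonneg _), norm_sub_rev]
    exact abs_norm_sub_norm_le y x
  have h3 : ‖((max R ‖y‖ - max R ‖x‖) / max R ‖y‖)‖ * ‖y‖ ≤ ‖x - y‖ := by
    rw [Real.norm_eq_abs, abs_div, abs_of_pos hy, div_mul_eq_mul_div, div_le_iff₀ hy]
    exact mul_le_mul h2 (le_max_right _ _) (norm_nonneg _) (norm_nonneg _)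
  rw [e]
  refine (norm_add_le _ _).trans ?_
  rw [norm_smul, norm_smul, norm_mul, Real.norm_of_nonneg h0, mul_assoc]
  calc _ ≤ 1 * ‖x - y‖ + 1 * ‖x - y‖ := by gcongr
    _ = ((2 : NNReal) : ℝ) * ‖x - y‖ := by push_cast; ring

theorem HasDerivWithinAt.comp_neg_Icc {T : ℝ} {x : ℝ → E} {x' : E} {t : ℝ}
    (h : HasDerivWithinAt x x' (Icc (-T) T) (-t)) :
    HasDerivWithinAt (fun s => x (-s)) (-x') (Icc (-T) T) t := by
  have := h.scomp t (hasDerivWithinAt_neg t (Icc (-T) T))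
    (fun s hs => ⟨by linarith [hs.2], by linarith [hs.1]⟩)
  simpa using! this

/-- Grönwall's inequality forward from `0`, and backward by reversing time. It supplies the a priori
bound that makes truncation of a linear equation harmless. -/
theorem norm_le_mul_exp_of_norm_deriv_le {T K : ℝ} (hT : 0 ≤ T) (hK : 0 ≤ K) {x x' : ℝ → E}
    (hx : ∀ t ∈ Icc (-T) T, HasDerivWithinAt x (x' t) (Icc (-T) T) t)
    (hK' : ∀ t ∈ Icc (-T) T, ‖x' t‖ ≤ K * ‖x t‖) :
    ∀ t ∈ Icc (-T) T, ‖x t‖ ≤ ‖x 0‖ * Real.exp (K * T) := by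
  have key : ∀ y y' : ℝ → E, (∀ t ∈ Icc (-T) T, HasDerivWithinAt y (y' t) (Icc (-T) T) t) →
      (∀ t ∈ Icc (-T) T, ‖y' t‖ ≤ K * ‖y t‖) →
      ∀ t ∈ Icc 0 T, ‖y t‖ ≤ ‖y 0‖ * Real.exp (K * T) := by
    intro y y' hy hy' t ht
    have hsub : Icc 0 T ⊆ Icc (-T) T := Icc_subset_Icc_left (by linarith)
    have := norm_le_gronwallBound_of_norm_deriv_right_le (f := y) (f' := y') (δ := ‖y 0‖) (K := K)
      (ε := 0) (a := 0) (b := T)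
      (fun s hs => ((hy s (hsub hs)).continuousWithinAt).mono hsub)
      (fun s hs => (hy s (hsub (Ico_subset_Icc_self hs))).mono_of_mem_nhdsWithin
        (Icc_mem_nhdsGE_of_mem ⟨by linarith [hs.1, hs.2], hs.2⟩)) le_rfl
      (fun s hs => by simpa using hy' s (hsub (Ico_subset_Icc_self hs))) t ht
    rw [gronwallBound_ε0] at this
    refine this.trans ?_
    gcongr
    linarith [ht.2]
  intro t ht
  rcases le_total 0 t with h | h
  · exact key x x' hx hK' t ⟨h, ht.2⟩
  · have := key (fun s => x (-s)) (fun s => -x' (-s))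
      (fun s hs => (hx (-s) ⟨by linarith [hs.2], by linarith [hs.1]⟩).comp_neg_Icc)
      (fun s hs => by
        rw [norm_neg]
        exact hK' (-s) ⟨by linarith [hs.2], by linarith [hs.1]⟩) (-t) ⟨by linarith, by linarith [ht.1]⟩
    simpa using this

/-- A linear differential equation with continuous coefficients on a compact interval has a solution
on the whole interval. -/
theorem exists_solution_linearODE [CompleteSpace E] {T : ℝ} (hT : 0 ≤ T) {A : ℝ → E →L[ℝ] E}
    (hA : ContinuousOn A (Icc (-T) T)) (x₀ : E) :
    ∃ x : ℝ → E, x 0 = x₀ ∧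
      ∀ t ∈ Icc (-T) T, HasDerivWithinAt x (A t (x t)) (Icc (-T) T) t := by
  obtain ⟨K₀, hK₀⟩ := isCompact_Icc.exists_bound_of_continuousOn hA
  obtain ⟨K, hK⟩ : ∃ K : NNReal, ∀ t ∈ Icc (-T) T, ‖A t‖ ≤ K :=
    ⟨K₀.toNNReal, fun t ht => (hK₀ t ht).trans (Real.le_coe_toNNReal _)⟩
  -- `R` dominates the Grönwall bound, so solutions of the truncated equation stay where the
  -- truncation is the identity.
  obtain ⟨R, hR, hR'⟩ : ∃ R : NNReal, (0 : ℝ) < R ∧ ‖x₀‖ * Real.exp (K * T) ≤ R :=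
    ⟨⟨‖x₀‖ * Real.exp (K * T) + 1, by positivity⟩, by
      change 0 < ‖x₀‖ * Real.exp (K * T) + 1; positivity, by
      change _ ≤ ‖x₀‖ * Real.exp (K * T) + 1; linarith⟩
  -- After truncation the field is bounded by `K * R` on the whole space, so the Picard–Lindelöf
  -- ball can be given the radius `K * R * T` needed to reach time `T`.
  have hpl : IsPicardLindelof (fun t x => A t (radialRetraction R x)) (tmin := -T) (tmax := T)
      ⟨0, by constructor <;> linarith⟩ x₀ (K * R * ⟨T, hT⟩) 0 (K * R) (K * 2) := by
    refine ⟨fun t ht => ?_, fun x _ => ?_, fun t ht x _ => ?_, ?_⟩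
    · exact (((A t).lipschitz.weaken (show ‖A t‖₊ ≤ K from hK t ht)).comp
        (lipschitzWith_radialRetraction hR)).lipschitzOnWith
    · exact hA.clm_apply continuousOn_const
    · refine ((A t).le_opNorm _).trans ?_
      push_cast
      exact mul_le_mul (hK t ht) (norm_radialRetraction_le hR x) (norm_nonneg _) K.2
    · simp only [sub_zero, zero_sub, neg_neg, max_self, NNReal.coe_zero]
      rfl
  obtain ⟨x, hx0, hx⟩ := hpl.exists_eq_forall_mem_Icc_hasDerivWithinAt₀
  refine ⟨x, hx0, fun t ht => ?_⟩
  -- The retraction does not increase norms, so the truncated equation obeys the same growth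
  -- inequality as the linear one.
  have hb := norm_le_mul_exp_of_norm_deriv_le hT K.2 hx (fun s hs =>
    ((A s).le_opNorm _).trans (mul_le_mul (hK s hs) (norm_radialRetraction_le_norm hR _)
      (norm_nonneg _) K.2)) t ht
  have := hx t ht
  dsimp only at hx0
  rw [hx0] at hb
  rwa [radialRetraction_of_norm_le hR (hb.trans hR')] at this

end LinearODE

/-! ### Derivatives of curves in projective limits of normed spaces -/

-- The product need not be normable, so the derivative is expressed by the little-o relation of
-- topological vector spaces. The inclusion of the subspace is inducing, hence preserves this
-- relation, and in the product it is tested coordinatewise.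
open Asymptotics in
theorem hasDerivAt_submodule_pi {ι : Type*} {F : ι → Type*} [∀ i, NormedAddCommGroup (F i)]
    [∀ i, NormedSpace ℝ (F i)] (p : Submodule ℝ (∀ i, F i)) {u : ℝ → p} {u' : p} {t : ℝ} :
    HasDerivAt u u' t ↔ ∀ i, HasDerivAt (fun s => (u s).1 i) (u'.1 i) t := by
  have h (f : ℝ → p) (g : ℝ → ℝ) : f =o[ℝ; 𝓝 t] g ↔ ∀ i, (fun s => (f s).1 i) =o[ℝ; 𝓝 t] g := by
    have e : (p.subtypeL ∘ f) =Θ[ℝ; 𝓝 t] f :=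
      p.subtypeL.isThetaTVS_comp Topology.IsInducing.subtypeVal
    exact ⟨fun h => isLittleOTVS_pi.1 (e.trans_isLittleOTVS h),
      fun h => e.symm.trans_isLittleOTVS (isLittleOTVS_pi.2 h)⟩
  simp only [hasDerivAt_iff_hasFDerivAt, hasFDerivAt_iff_isLittleOTVS]
  rw [h]
  rfl

/-! ### Charts of tangent bundles -/

section Charts

variable {E H M : Type*} [NormedAddCommGroup E] [NormedSpace ℝ E] [TopologicalSpace H]
  {I : ModelWithCorners ℝ E H} [TopologicalSpace M] [ChartedSpace H M] [IsManifold I ∞ M]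
  {E' H' N : Type*} [NormedAddCommGroup E'] [NormedSpace ℝ E'] [TopologicalSpace H']
  {I' : ModelWithCorners ℝ E' H'} [TopologicalSpace N] [ChartedSpace H' N] [IsManifold I' ∞ N]

/-- Induced charts depend only on the base point; this permits replacing the fibre component of a
reference point at will, for instance by `0`. -/
theorem extChartAt_tangent_congr {p q : TangentBundle I M} (h : p.1 = q.1) :
    extChartAt I.tangent p = extChartAt I.tangent q := by
  obtain ⟨x, v⟩ := p
  obtain ⟨y, w⟩ := q
  subst h
  rfl

theorem extChartAt_tangent_tangent_congr {p q : TangentBundle I.tangent (TangentBundle I M)}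
    (h : p.1.1 = q.1.1) :
    extChartAt I.tangent.tangent p = extChartAt I.tangent.tangent q := by
  obtain ⟨⟨x, v⟩, w⟩ := p
  obtain ⟨⟨y, w⟩, w'⟩ := q
  subst h
  rfl

theorem mem_extChartAt_tangent_source {p z : TangentBundle I M} :
    z ∈ (extChartAt I.tangent p).source ↔ z.1 ∈ (extChartAt I p.1).source := by
  simp only [extChartAt_source, TangentBundle.mem_chart_source_iff]

theorem mem_extChartAt_tangent_target [I.Boundaryless] {p : TangentBundle I M} {w : E × E} :
    w ∈ (extChartAt I.tangent p).target ↔ w.1 ∈ (extChartAt I p.1).target := by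
  rw [extChartAt_target, extChartAt_target, I.range_eq_univ, I.tangent.range_eq_univ, inter_univ,
    inter_univ, mem_preimage, mem_preimage, TangentBundle.mem_chart_target_iff]
  rfl

theorem extChartAt_tangent_self (z : TangentBundle I M) :
    extChartAt I.tangent z z = (extChartAt I z.1 z.1, (z.2 : E)) :=
  Prod.ext rfl (tangentCoordChange_self (I := I) (mem_extChartAt_source z.1))

theorem hasMFDerivAt_extChartAt_tangentCoordChange {p x : M} (h : x ∈ (extChartAt I p).source) :
    HasMFDerivAt I 𝓘(ℝ, E) (extChartAt I p) x (tangentCoordChange (E := E) I x p x) :=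
  ⟨continuousAt_extChartAt' h,
    hasFDerivWithinAt_tangentCoordChange ⟨mem_extChartAt_source x, h⟩⟩

/-- The local expression of a tangent map in charts. -/
theorem extChartAt_tangentMap {F : M → N} {p z : TangentBundle I M} {q : TangentBundle I' N}
    (hz : z.1 ∈ (extChartAt I p.1).source) (hq : F z.1 ∈ (extChartAt I' q.1).source)
    (hF : MDifferentiableAt I I' F z.1) {G : E → E'} {G' : E →L[ℝ] E'}
    (hG : HasFDerivAt G G' (extChartAt I p.1 z.1))
    (hev : ∀ᶠ y in 𝓝 z.1, extChartAt I' q.1 (F y) = G (extChartAt I p.1 y)) :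
    extChartAt I'.tangent q (tangentMap I I' F z) =
      (G (extChartAt I p.1 z.1), G' (extChartAt I.tangent p z).2) := by
  refine Prod.ext hev.self_of_nhds ?_
  have h1 := (hasMFDerivAt_extChartAt_tangentCoordChange hq).comp z.1 hF.hasMFDerivAt
  have h2 := hG.hasMFDerivAt.comp z.1 (hasMFDerivAt_extChartAt_tangentCoordChange hz)
  exact DFunLike.congr_fun (hasMFDerivAt_unique h1 (h2.congr_of_eventuallyEq hev)) z.2

theorem mdifferentiableAt_curve_of_extChartAt [I.Boundaryless] {γ : ℝ → M} {t : ℝ} {p : M}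
    (hc : ContinuousAt γ t) (hp : γ t ∈ (extChartAt I p).source)
    (h : DifferentiableAt ℝ (fun s => extChartAt I p (γ s)) t) :
    MDifferentiableAt 𝓘(ℝ, ℝ) I γ t := by
  have h1 : MDifferentiableAt 𝓘(ℝ, E) I (extChartAt I p).symm (extChartAt I p (γ t)) :=
    ((contMDiffOn_extChartAt_symm (I := I) (n := ∞) p).contMDiffAt
      ((isOpen_extChartAt_target p).mem_nhds ((extChartAt I p).map_source hp))).mdifferentiableAt
        (by simp)
  refine (h1.comp t h.mdifferentiableAt).congr_of_eventuallyEq ?_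
  filter_upwards [hc.preimage_mem_nhds (extChartAt_source_mem_nhds' hp)] with y hy
  exact ((extChartAt I p).left_inv hy).symm

/-- The local expression of the velocity of a curve in a chart. -/
theorem extChartAt_curveLift {γ : ℝ → M} {t : ℝ} {p : TangentBundle I M} {u : ℝ → E} {u' : E}
    (hγ : MDifferentiableAt 𝓘(ℝ, ℝ) I γ t) (hp : γ t ∈ (extChartAt I p.1).source)
    (hu : HasDerivAt u u' t) (hev : ∀ᶠ s in 𝓝 t, extChartAt I p.1 (γ s) = u s) :
    extChartAt I.tangent p (curveLift I γ t) = (u t, u') := by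
  refine Prod.ext hev.self_of_nhds ?_
  have h1 := (hasMFDerivAt_extChartAt_tangentCoordChange hp).comp t hγ.hasMFDerivAt
  have h2 := (hu.congr_of_eventuallyEq hev).hasFDerivAt.hasMFDerivAt
  have := DFunLike.congr_fun (hasMFDerivAt_unique h1 h2) (1 : ℝ)
  refine this.trans ?_
  exact one_smul ℝ u'

end Charts

/-- Vectors at the same point are separated in a local trivialization, vectors at different points
by pulling back neighbourhoods from the base. -/
instance tangentBundle_t2Space {E H M : Type*} [NormedAddCommGroup E] [NormedSpace ℝ E]
    [TopologicalSpace H] {I : ModelWithCorners ℝ E H} [TopologicalSpace M] [ChartedSpace H M]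
    [IsManifold I 1 M] [T2Space M] : T2Space (TangentBundle I M) := by
  refine ⟨fun x y hxy => ?_⟩
  by_cases h : x.1 = y.1
  · let e := trivializationAt E (TangentSpace I) x.1
    have hx : x ∈ e.source := e.mem_source.2 (FiberBundle.mem_baseSet_trivializationAt' x.1)
    have hy : y ∈ e.source := e.mem_source.2 (h ▸ FiberBundle.mem_baseSet_trivializationAt' x.1)
    obtain ⟨U, V, hU, hV, hxU, hyV, hd⟩ := t2_separation (fun h' => hxy (e.injOn hx hy h'))
    refine ⟨e.source ∩ e ⁻¹' U, e.source ∩ e ⁻¹' V,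
      e.continuousOn.isOpen_inter_preimage e.open_source hU,
      e.continuousOn.isOpen_inter_preimage e.open_source hV, ⟨hx, hxU⟩, ⟨hy, hyV⟩, ?_⟩
    exact (hd.preimage e).mono inter_subset_right inter_subset_right
  · exact separated_by_continuous (FiberBundle.continuous_proj E (TangentSpace I)) h

/-! ### Local expressions of second order vector fields and of their complete lifts -/

section LocalForm

variable {E H M : Type*} [NormedAddCommGroup E] [NormedSpace ℝ E] [TopologicalSpace H]
  {I : ModelWithCorners ℝ E H} [TopologicalSpace M] [ChartedSpace H M] [IsManifold I ∞ M]

/-- A smooth vector field on `TM`. -/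
structure IsSmoothField (S : TangentBundle I M → TangentBundle I.tangent (TangentBundle I M)) :
    Prop where
  contMDiff : ContMDiff I.tangent I.tangent.tangent ∞ S
  proj : ∀ v, (S v).proj = v

/-- In the charts induced by the preferred chart of `M` at `p`, the vector field `S` on `TM` is
`(x, v) ↦ (x, v, v, f (x, v))`. -/
structure HasLocalForm (S : TangentBundle I M → TangentBundle I.tangent (TangentBundle I M))
    (p : M) (f : E × E → E) : Prop where
  contDiffOn : ContDiffOn ℝ ∞ f ((extChartAt I p).target ×ˢ univ)
  apply : ∀ z : TangentBundle I M, z.1 ∈ (extChartAt I p).source →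
    ∀ q : TangentBundle I.tangent (TangentBundle I M), q.1.1 = p →
      extChartAt I.tangent.tangent q (S z) = (extChartAt I.tangent q.1 z,
        ((extChartAt I.tangent q.1 z).2, f (extChartAt I.tangent q.1 z)))

theorem IsSemispray.isSmoothField
    {S : TangentBundle I M → TangentBundle I.tangent (TangentBundle I M)}
    (hS : IsSemispray I S) : IsSmoothField S := ⟨hS.contMDiff, hS.proj⟩

/-- The section property fixes the first two of the four coordinates of `S z`, and invariance under
the flip forces the third to equal the second; `f` is the remaining one. Later levels inherit the
local form from `hasLocalForm_completeLift`, so invariance is needed only here. -/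
theorem IsSemispray.exists_hasLocalForm [I.Boundaryless]
    {S : TangentBundle I M → TangentBundle I.tangent (TangentBundle I M)}
    (hS : IsSemispray I S) (p : M) : ∃ f, HasLocalForm S p f := by
  let o : TangentBundle I M := ⟨p, (0 : E)⟩
  let oo : TangentBundle I.tangent (TangentBundle I M) := ⟨o, (0 : E × E)⟩
  refine ⟨fun w => (extChartAt I.tangent.tangent oo (S ((extChartAt I.tangent o).symm w))).2.2,
    ?_, ?_⟩
  · intro w hw
    have hw' : w ∈ (extChartAt I.tangent o).target := mem_extChartAt_tangent_target.2 hw.1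
    have hs : S ((extChartAt I.tangent o).symm w) ∈ (extChartAt I.tangent.tangent oo).source := by
      rw [mem_extChartAt_tangent_source, hS.proj]
      exact (extChartAt I.tangent o).map_target hw'
    have h1 := (contMDiffOn_extChartAt_symm (I := I.tangent) (n := ∞) o).contMDiffAt
      ((isOpen_extChartAt_target o).mem_nhds hw')
    have h2 := (contMDiffAt_extChartAt' (I := I.tangent.tangent) (n := ∞) (x := oo)
      (by rwa [extChartAt_source] at hs)).comp w ((hS.contMDiff _).comp w h1)
    exact (h2.contDiffAt.snd.snd).contDiffWithinAt
  · intro z hz q hq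
    have e1 : extChartAt I.tangent q.1 = extChartAt I.tangent o := extChartAt_tangent_congr hq
    have e2 : extChartAt I.tangent.tangent q = extChartAt I.tangent.tangent oo :=
      extChartAt_tangent_tangent_congr hq
    have hz' : z ∈ (extChartAt I.tangent o).source := mem_extChartAt_tangent_source.2 hz
    have h1 : (extChartAt I.tangent.tangent oo (S z)).1 = extChartAt I.tangent o z :=
      congrArg (extChartAt I.tangent o) (hS.proj z)
    have h2 := extChartAt_canonicalFlip I oo (S z) (by rw [hS.proj]; exact hz)
    rw [hS.flip] at h2
    have h3 : (extChartAt I.tangent.tangent oo (S z)).1.2 =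
        (extChartAt I.tangent.tangent oo (S z)).2.1 := congrArg (fun w => w.1.2) h2
    rw [e1, e2, (extChartAt I.tangent o).left_inv hz']
    refine Prod.ext h1 (Prod.ext ?_ rfl)
    rw [← h3, h1]

/-- For the section property: by `tangentMap_base` the flip on `TTTM` turns the base projection into
`Tπ`, and `Tπ ∘ TS = id` because `π ∘ S = id`. What remains is `κ ∘ κ = id`. -/
theorem isSmoothField_completeLift [I.Boundaryless]
    {S : TangentBundle I M → TangentBundle I.tangent (TangentBundle I M)} (hS : IsSmoothField S) :
    IsSmoothField (completeLift I S) where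
  contMDiff := ((contMDiff_canonicalFlip I (M := M)).contMDiff_tangentMap (by simp)).comp
    ((contMDiff_canonicalFlip I.tangent (M := TangentBundle I M)).comp
      ((hS.contMDiff.contMDiff_tangentMap (by simp)).comp (contMDiff_canonicalFlip I)))
  proj z := by
    have h1 := tangentMap_base I.tangent (tangentMap I.tangent I.tangent.tangent S (canonicalFlip I z))
    have hp : ContMDiff I.tangent.tangent I.tangent ∞ (Bundle.TotalSpace.proj :
        TangentBundle I.tangent (TangentBundle I M) → TangentBundle I M) :=
      contMDiff_tangentBundle_proj I.tangent
    have h2 : tangentMap I.tangent.tangent I.tangent (Bundle.TotalSpace.proj :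
        TangentBundle I.tangent (TangentBundle I M) → TangentBundle I M)
        (tangentMap I.tangent I.tangent.tangent S (canonicalFlip I z)) = canonicalFlip I z := by
      rw [← Function.comp_apply (f := tangentMap I.tangent.tangent I.tangent _),
        ← tangentMap_comp (hp.mdifferentiable (by simp)) (hS.contMDiff.mdifferentiable (by simp)),
        show Bundle.TotalSpace.proj ∘ S = id from funext hS.proj, tangentMap_id]
      rfl
    change canonicalFlip I (canonicalFlip I.tangent (tangentMap I.tangent I.tangent.tangent S
      (canonicalFlip I z))).1 = z
    rw [← h1, h2, canonicalFlip_canonicalFlip]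

/-- The local expression of the complete lift of a vector field with local expression `f`. -/
def localLift (f : E × E → E) (w : (E × E) × (E × E)) : E × E :=
  (f (w.1.1, w.2.1), fderiv ℝ f (w.1.1, w.2.1) (w.1.2, w.2.2))

variable (E) in
/-- The linear involution `(x, y, X, Y) ↦ (x, X, y, Y)`. -/
def linearFlip : (E × E) × (E × E) →L[ℝ] (E × E) × (E × E) :=
  (((ContinuousLinearMap.fst ℝ E E).comp (ContinuousLinearMap.fst ℝ _ _)).prod
    ((ContinuousLinearMap.fst ℝ E E).comp (ContinuousLinearMap.snd ℝ _ _))).prod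
  (((ContinuousLinearMap.snd ℝ E E).comp (ContinuousLinearMap.fst ℝ _ _)).prod
    ((ContinuousLinearMap.snd ℝ E E).comp (ContinuousLinearMap.snd ℝ _ _)))

theorem extChartAt_canonicalFlip_eq_linearFlip [I.Boundaryless]
    {q q' z : TangentBundle I.tangent (TangentBundle I M)} (hq : q.1.1 = q'.1.1)
    (hz : z.1.1 ∈ (extChartAt I q.1.1).source) :
    extChartAt I.tangent.tangent q' (canonicalFlip I z) =
      linearFlip E (extChartAt I.tangent.tangent q z) := by
  rw [extChartAt_tangent_tangent_congr (q := canonicalFlip I q) hq.symm]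
  exact extChartAt_canonicalFlip I q z hz

theorem contDiffOn_localLift {f : E × E → E} {U : Set E} (hU : IsOpen U)
    (hf : ContDiffOn ℝ ∞ f (U ×ˢ univ)) :
    ContDiffOn ℝ ∞ (localLift f) {w | w.1.1 ∈ U} := by
  have hU' : IsOpen (U ×ˢ (univ : Set E)) := hU.prod isOpen_univ
  have hm : MapsTo (fun w : (E × E) × (E × E) => (w.1.1, w.2.1)) {w | w.1.1 ∈ U} (U ×ˢ univ) :=
    fun w hw => ⟨hw, mem_univ _⟩
  have hc : ContDiff ℝ ∞ (fun w : (E × E) × (E × E) => (w.1.1, w.2.1)) :=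
    contDiff_fst.fst.prodMk contDiff_snd.fst
  exact (hf.comp hc.contDiffOn hm).prodMk
    (((hf.fderiv_of_isOpen hU' (m := ∞) (by simp)).comp hc.contDiffOn hm).clm_apply
      (contDiff_fst.snd.prodMk contDiff_snd.snd).contDiffOn)

/-- A computation in charts: each flip is a linear permutation of coordinates, and `TS` contributes
the derivative of `v ↦ (v, v.2, f v)`. The outcome couples the equation of `f` with its
linearization. -/
theorem hasLocalForm_completeLift [I.Boundaryless]
    {S : TangentBundle I M → TangentBundle I.tangent (TangentBundle I M)} (hS : IsSmoothField S)
    {f : E × E → E} {p : M} (hf : HasLocalForm S p f) {P : TangentBundle I M} (hP : P.1 = p) :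
    HasLocalForm (completeLift I S) P (localLift f) := by
  subst hP
  have hU : IsOpen ((extChartAt I P.1).target ×ˢ (univ : Set E)) :=
    (isOpen_extChartAt_target P.1).prod isOpen_univ
  refine ⟨(contDiffOn_localLift (isOpen_extChartAt_target P.1) hf.contDiffOn).mono fun w hw =>
    mem_extChartAt_tangent_target.1 hw.1, fun z hz q hq => ?_⟩
  have hz' : z.1.1 ∈ (extChartAt I P.1).source := mem_extChartAt_tangent_source.1 hz
  subst hq
  have hk := (contMDiff_canonicalFlip I (M := M)).mdifferentiable (by simp)
  have hSd := hS.contMDiff.mdifferentiable (by simp)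
  obtain ⟨y, hy⟩ : ∃ y, y = canonicalFlip I z := ⟨_, rfl⟩
  have hyz : y.1.1 = z.1.1 := by rw [hy]; rfl
  have e1 : extChartAt I.tangent.tangent q.1 y =
      linearFlip E (extChartAt I.tangent.tangent q.1 z) :=
    hy ▸ extChartAt_canonicalFlip_eq_linearFlip (z := z) rfl hz'
  -- In coordinates `w = ((x, y), (X, Y))`, and its flip `y` has coordinates `((x, X), (y, Y))`.
  obtain ⟨w, hw⟩ : ∃ w, w = extChartAt I.tangent.tangent q.1 z := ⟨_, rfl⟩
  have hy1 : extChartAt I.tangent q.1.1 y.1 = (w.1.1, w.2.1) := by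
    have := congrArg Prod.fst e1
    rw [← hw] at this
    exact this
  have hy2 : (extChartAt I.tangent.tangent q.1 y).2 = (w.1.2, w.2.2) := by rw [e1, ← hw]; rfl
  have hfd : HasFDerivAt f (fderiv ℝ f (w.1.1, w.2.1)) (w.1.1, w.2.1) := by
    refine ((hf.contDiffOn.contDiffAt (hU.mem_nhds ?_)).differentiableAt (by simp)).hasFDerivAt
    refine ⟨?_, mem_univ _⟩
    have : w.1.1 = extChartAt I q.1.1.1 z.1.1 := by rw [hw]; rfl
    rw [this]
    exact (extChartAt I q.1.1.1).map_source hz'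
  obtain ⟨L, hL⟩ : ∃ L, L = fderiv ℝ f (w.1.1, w.2.1) := ⟨_, rfl⟩
  rw [← hL] at hfd
  let Q : TangentBundle I.tangent.tangent (TangentBundle I.tangent (TangentBundle I M)) :=
    ⟨q.1, (0 : (E × E) × (E × E))⟩
  have e2 : extChartAt I.tangent.tangent.tangent Q (tangentMap I.tangent I.tangent.tangent S y) =
      (((w.1.1, w.2.1), (w.2.1, f (w.1.1, w.2.1))),
        ((w.1.2, w.2.2), (w.2.2, L (w.1.2, w.2.2)))) := by
    have hG : HasFDerivAt (fun v : E × E => (v, (v.2, f v)))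
        ((ContinuousLinearMap.id ℝ (E × E)).prod ((ContinuousLinearMap.snd ℝ E E).prod L))
        (extChartAt I.tangent q.1.1 y.1) := by
      rw [hy1]
      exact (hasFDerivAt_id _).prodMk (hasFDerivAt_snd.prodMk hfd)
    have := extChartAt_tangentMap (F := S) (p := q.1) (z := y) (q := Q)
      (mem_extChartAt_tangent_source.2 (by rw [hyz]; exact hz'))
      (by
        rw [mem_extChartAt_tangent_source, hS.proj, mem_extChartAt_tangent_source, hyz]
        exact hz') (hSd y.1) hG (by
        have ho : ∀ᶠ v in 𝓝 y.1, v ∈ (extChartAt I.tangent q.1.1).source :=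
          extChartAt_source_mem_nhds' (mem_extChartAt_tangent_source.2 (by rw [hyz]; exact hz'))
        filter_upwards [ho] with v hv
        exact hf.apply v (mem_extChartAt_tangent_source.1 hv) q.1 rfl)
    rw [this, hy1, hy2]
    rfl
  obtain ⟨a, ha⟩ : ∃ a, a = tangentMap I.tangent I.tangent.tangent S y := ⟨_, rfl⟩
  have ha1 : a.1.1 = y.1 := by rw [ha]; exact hS.proj _
  obtain ⟨b, hb⟩ : ∃ b, b = canonicalFlip I.tangent a := ⟨_, rfl⟩
  have hb1 : b.1.1 = y.1 := by rw [hb, ← ha1]; rfl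
  rw [← ha] at e2
  have e3 : extChartAt I.tangent.tangent.tangent Q b =
      (((w.1.1, w.2.1), (w.1.2, w.2.2)),
        ((w.2.1, f (w.1.1, w.2.1)), (w.2.2, L (w.1.2, w.2.2)))) := by
    rw [hb, extChartAt_canonicalFlip_eq_linearFlip (q := Q) (q' := Q) rfl, e2]
    · rfl
    · rw [ha1]
      exact mem_extChartAt_tangent_source.2 (by rw [hyz]; exact hz')
  have hbs : b.1 ∈ (extChartAt I.tangent.tangent q.1).source :=
    mem_extChartAt_tangent_source.2 (mem_extChartAt_tangent_source.2 (by
      rw [hb1, hyz]; exact hz'))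
  -- Since the flip is linear in charts, its tangent map acts by the same permutation on points and
  -- on vectors.
  have e4 := extChartAt_tangentMap (F := canonicalFlip I (M := M)) (p := Q) (z := b) (q := q)
    hbs
    (mem_extChartAt_tangent_source.2 (mem_extChartAt_tangent_source.2 (by
      change b.1.1.1 ∈ _; rw [hb1, hyz]; exact hz'))) (hk b.1)
    (linearFlip E).hasFDerivAt (by
      filter_upwards [extChartAt_source_mem_nhds' hbs] with v hv
      exact extChartAt_canonicalFlip_eq_linearFlip (q := q.1) (q' := q.1) rfl
        (mem_extChartAt_tangent_source.1 (mem_extChartAt_tangent_source.1 hv)))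
  have e5 : extChartAt I.tangent.tangent q.1 b.1 = ((w.1.1, w.2.1), (w.1.2, w.2.2)) :=
    congrArg Prod.fst e3
  have e6 : completeLift I S z = tangentMap I.tangent.tangent I.tangent.tangent (canonicalFlip I) b := by
    rw [hb, ha, hy]; rfl
  rw [e6, e4, e3, ← hw]
  change (linearFlip E (extChartAt I.tangent.tangent q.1 b.1), _) = _
  rw [e5, localLift, ← hL]
  rfl

end LocalForm

/-! ### Velocities of curves in manifolds and in projective limits of manifolds -/

section Velocity

variable {E H M : Type*} [NormedAddCommGroup E] [NormedSpace ℝ E] [TopologicalSpace H]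
  {I : ModelWithCorners ℝ E H} [TopologicalSpace M] [ChartedSpace H M]

/-- Puts the velocity into the form required by `IsMIntegralCurveOn`. -/
theorem MDifferentiableAt.hasMFDerivAt_curveLift {γ : ℝ → M} {t : ℝ} (hγ : MDifferentiableAt 𝓘(ℝ, ℝ) I γ t) :
    HasMFDerivAt 𝓘(ℝ, ℝ) I γ t
      ((1 : ℝ →L[ℝ] ℝ).smulRight ((curveLift I γ t).2 : E)) := by
  have e : (1 : ℝ →L[ℝ] ℝ).smulRight ((curveLift I γ t).2 : E) =
      (mfderiv 𝓘(ℝ, ℝ) I γ t : ℝ →L[ℝ] E) :=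
    ContinuousLinearMap.ext_ring (one_smul ℝ _)
  exact (congrArg (HasMFDerivAt 𝓘(ℝ, ℝ) I γ t) e).mpr hγ.hasMFDerivAt

theorem curveLift_congr {γ₁ γ₂ : ℝ → M} {t : ℝ} (h : γ₁ =ᶠ[𝓝 t] γ₂) :
    curveLift I γ₁ t = curveLift I γ₂ t :=
  Bundle.TotalSpace.ext h.self_of_nhds
    (heq_of_eq (congrArg (fun L : ℝ →L[ℝ] E => L 1) (h.mfderiv_eq (I := 𝓘(ℝ, ℝ)) (I' := I))))

variable [IsManifold I ∞ M]

theorem hasDerivAt_extChartAt_of_curveLift_eq {γ : ℝ → M} {t : ℝ} {ζ : TangentBundle I M}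
    (hγ : MDifferentiableAt 𝓘(ℝ, ℝ) I γ t) (h : curveLift I γ t = ζ) :
    HasDerivAt (fun s => extChartAt I (γ t) (γ s)) (ζ.2 : E) t := by
  subst h
  have h1 := ((hasMFDerivAt_extChartAt_tangentCoordChange (I := I)
    (mem_extChartAt_source (I := I) (γ t))).comp t hγ.hasMFDerivAt)
  have h2 : HasFDerivAt (fun s => extChartAt I (γ t) (γ s))
      ((tangentCoordChange I (γ t) (γ t) (γ t)).comp (mfderiv 𝓘(ℝ, ℝ) I γ t : ℝ →L[ℝ] E)) t :=
    hasMFDerivAt_iff_hasFDerivAt.1 h1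
  refine h2.hasDerivAt.congr_deriv ?_
  exact tangentCoordChange_self (I := I) (mem_extChartAt_source (γ t))

theorem curveLift_eq_of_hasDerivAt [I.Boundaryless] {γ : ℝ → M} {t : ℝ} {ζ : TangentBundle I M}
    (hc : ContinuousAt γ t) (hζ : ζ.1 = γ t)
    (h : HasDerivAt (fun s => extChartAt I (γ t) (γ s)) (ζ.2 : E) t) :
    MDifferentiableAt 𝓘(ℝ, ℝ) I γ t ∧ curveLift I γ t = ζ := by
  have hd := mdifferentiableAt_curve_of_extChartAt hc (mem_extChartAt_source (I := I) (γ t))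
    h.differentiableAt
  refine ⟨hd, ?_⟩
  have h1 := extChartAt_curveLift (p := ζ) hd (by rw [hζ]; exact mem_extChartAt_source _) h
    (by rw [hζ]; exact .of_forall fun _ => rfl)
  refine (extChartAt I.tangent ζ).injOn ?_ (mem_extChartAt_source ζ) ?_
  · rw [mem_extChartAt_tangent_source, hζ]
    exact mem_extChartAt_source (γ t)
  · rw [h1, extChartAt_tangent_self, hζ]
    rfl

end Velocity

theorem ContDiffAt.hasDerivAt_iteratedDeriv {F : Type*} [NormedAddCommGroup F] [NormedSpace ℝ F]
    {u : ℝ → F} {t : ℝ} (h : ContDiffAt ℝ ∞ u t) (n : ℕ) :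
    HasDerivAt (iteratedDeriv n u) (iteratedDeriv (n + 1) u t) t := by
  rw [iteratedDeriv_succ, hasDerivAt_deriv_iff]
  have := h.differentiableAt_iteratedFDeriv (m := n) (by exact_mod_cast WithTop.coe_lt_top _)
  exact (ContinuousMultilinearMap.apply ℝ (fun _ : Fin n => ℝ) F
    (fun _ => 1)).differentiableAt.comp t this

theorem ContinuousLinearMap.iteratedDeriv_comp_left {F G : Type*} [NormedAddCommGroup F]
    [NormedSpace ℝ F] [NormedAddCommGroup G] [NormedSpace ℝ G] (L : F →L[ℝ] G)
    {u : ℝ → F} {t : ℝ} (h : ContDiffAt ℝ ∞ u t) (n : ℕ) :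
    iteratedDeriv n (fun s => L (u s)) t = L (iteratedDeriv n u t) := by
  have := L.iteratedFDeriv_comp_left h (i := n) (by exact_mod_cast le_top)
  exact congrArg (fun A : ContinuousMultilinearMap ℝ (fun _ : Fin n => ℝ) G => A fun _ => 1) this

namespace ProjSystem

variable (P : ProjSystem.{u})

/-- Membership in all chart domains is decided at index `0`, so a single neighbourhood serves
infinitely many indices at once. -/
theorem mem_source_iff_zero (x y : P.Lim) (i : ℕ) :
    y.1 i ∈ (extChartAt (P.X i).I (x.1 i)).source ↔
      y.1 0 ∈ (extChartAt (P.X 0).I (x.1 0)).source := by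
  induction i with
  | zero => rfl
  | succ i ih => rw [P.mem_source_iff, x.2, y.2, ih]

variable {P}

theorem chart_apply {x y : P.Lim} (h : y.1 0 ∈ (extChartAt (P.X 0).I (x.1 0)).source) (i : ℕ) :
    (P.chart x y).1 i = extChartAt (P.X i).I (x.1 i) (y.1 i) := by
  rw [chart, dif_pos fun i => (P.mem_source_iff_zero x y i).2 h]

theorem continuousAt_iff {γ : ℝ → P.Lim} {t : ℝ} :
    ContinuousAt γ t ↔ ∀ i, ContinuousAt (fun s => (γ s).1 i) t :=
  Topology.IsInducing.subtypeVal.continuousAt_iff.trans continuousAt_pi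

theorem chart_eventuallyEq {γ : ℝ → P.Lim} {t : ℝ} (hγ : ContinuousAt γ t) (i : ℕ) :
    ∀ᶠ s in 𝓝 t, (P.chart (γ t) (γ s)).1 i = extChartAt (P.X i).I ((γ t).1 i) ((γ s).1 i) := by
  filter_upwards [(continuousAt_iff.1 hγ 0).preimage_mem_nhds
    (extChartAt_source_mem_nhds (I := (P.X 0).I) _)] with s hs
  exact chart_apply hs i

theorem hasVelocityAt_iff {γ : ℝ → P.Lim} {ξ : P.tangent.Lim} {t : ℝ} :
    P.HasVelocityAt γ ξ t ↔ ∀ i, MDifferentiableAt 𝓘(ℝ, ℝ) (P.X i).I (fun s => (γ s).1 i) t ∧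
      curveLift (P.X i).I (fun s => (γ s).1 i) t = ξ.1 i := by
  constructor
  · rintro ⟨h1, h2, h3⟩ i
    refine curveLift_eq_of_hasDerivAt (continuousAt_iff.1 h2 i)
      (congrArg (fun x : P.Lim => x.1 i) h1) ?_
    refine HasDerivAt.congr_of_eventuallyEq ((hasDerivAt_submodule_pi _).1 h3 i) ?_
    filter_upwards [chart_eventuallyEq h2 i] with s hs
    exact hs.symm
  · intro h
    have hc : ContinuousAt γ t := continuousAt_iff.2 fun i => (h i).1.continuousAt
    refine ⟨Subtype.ext (funext fun i => congrArg Bundle.TotalSpace.proj (h i).2.symm), hc,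
      (hasDerivAt_submodule_pi _).2 fun i => ?_⟩
    exact (hasDerivAt_extChartAt_of_curveLift_eq (h i).1 (h i).2).congr_of_eventuallyEq
      (chart_eventuallyEq hc i)

/-- The connecting maps are linear in charts, so they commute with iterated derivatives. The
derivatives of the components are thus points of the model space, on a neighbourhood `V` independent
of the index and of the order. -/
theorem smoothCurveAt_of_contMDiffOn {γ : ℝ → P.Lim} {t : ℝ} {W : Set ℝ} (hW : W ∈ 𝓝 t)
    (h : ∀ i, ContMDiffOn 𝓘(ℝ, ℝ) (P.X i).I ∞ (fun s => (γ s).1 i) W) : P.SmoothCurveAt γ t := by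
  classical
  have hc : ContinuousAt γ t := continuousAt_iff.2 fun i => (h i).continuousOn.continuousAt hW
  obtain ⟨V, hVW, hV, htV⟩ := mem_nhds_iff.1 (inter_mem hW
    ((continuousAt_iff.1 hc 0).preimage_mem_nhds
      (extChartAt_source_mem_nhds (I := (P.X 0).I) ((γ t).1 0))))
  obtain ⟨v, hv⟩ : ∃ v : ∀ i, ℝ → (P.X i).E,
    v = fun i s => extChartAt (P.X i).I ((γ t).1 i) ((γ s).1 i) := ⟨_, rfl⟩
  have hvc : ∀ s ∈ V, ∀ i, (P.chart (γ t) (γ s)).1 i = v i s := fun s hs i => by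
    rw [hv]; exact chart_apply (hVW hs).2 i
  have hsm : ∀ s ∈ V, ∀ i, ContDiffAt ℝ ∞ (v i) s := fun s hs i => by
    have h1 : (γ s).1 i ∈ (chartAt (P.X i).H ((γ t).1 i)).source := by
      rw [← extChartAt_source (P.X i).I]
      exact (P.mem_source_iff_zero _ _ i).2 (hVW hs).2
    have h2 := (h i).contMDiffAt (mem_of_superset (hV.mem_nhds hs) fun s hs => (hVW hs).1)
    rw [hv]
    exact ((contMDiffAt_extChartAt' (n := ∞) h1).comp s h2).contDiffAt
  have hmap : ∀ n, ∀ s ∈ V, ∀ i,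
      P.modelMap i (iteratedDeriv n (v (i + 1)) s) = iteratedDeriv n (v i) s := fun n s hs i => by
    rw [← (P.modelMap i).iteratedDeriv_comp_left (hsm s hs (i + 1)) n]
    refine Filter.EventuallyEq.iteratedDeriv_eq n ?_
    filter_upwards [hV.mem_nhds hs] with r hr
    rw [← hvc r hr, ← hvc r hr]
    exact (P.chart (γ t) (γ r)).2 i
  -- Order `0` must be the chart expression for every `s`, junk values included; higher orders take
  -- the default `0` outside `V`.
  let d : ℕ → ℝ → P.model := fun n s =>
    if n = 0 then P.chart (γ t) (γ s) else
      if hs : s ∈ V then ⟨fun i => iteratedDeriv n (v i) s, hmap n s hs⟩ else 0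
  have hd : ∀ n, ∀ s ∈ V, ∀ i, (d n s).1 i = iteratedDeriv n (v i) s := fun n s hs i => by
    rcases eq_or_ne n 0 with rfl | hn
    · simp only [d, if_true, iteratedDeriv_zero]
      exact hvc s hs i
    · simp only [d, if_neg hn, dif_pos hs]
  refine ⟨hc, d, by simp only [d, if_true], ?_⟩
  filter_upwards [hV.mem_nhds htV] with s hs n
  refine (hasDerivAt_submodule_pi _).2 fun i => ?_
  rw [hd (n + 1) s hs i]
  refine ((hsm s hs i).hasDerivAt_iteratedDeriv n).congr_of_eventuallyEq ?_
  filter_upwards [hV.mem_nhds hs] with r hr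
  exact hd n r hr i

end ProjSystem

/-! ### Second order differential equations in a chart and their linearizations -/

section LocalGeodesic

variable {E : Type*} [NormedAddCommGroup E] [NormedSpace ℝ E]

/-- `z = (x, v) : [-ε, ε] → U × E` solves `x' = v`, `v' = f (x, v)`. -/
structure IsLocalGeodesic (U : Set E) (f : E × E → E) (ε : ℝ) (z : ℝ → E × E) : Prop where
  mem : ∀ t ∈ Icc (-ε) ε, (z t).1 ∈ U
  hasDerivWithinAt : ∀ t ∈ Icc (-ε) ε, HasDerivWithinAt z ((z t).2, f (z t)) (Icc (-ε) ε) t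

theorem IsLocalGeodesic.contDiffOn [CompleteSpace E] {U : Set E} {f : E × E → E}
    (hf : ContDiffOn ℝ ∞ f (U ×ˢ univ)) {ε : ℝ} {z : ℝ → E × E} (hz : IsLocalGeodesic U f ε z) :
    ContDiffOn ℝ ∞ z (Icc (-ε) ε) := by
  refine ODE.contDiffOn_enat_Icc_of_hasDerivWithinAt (n := ⊤) (u := U ×ˢ univ)
    (f := fun _ w => (w.2, f w)) ?_ hz.hasDerivWithinAt fun t ht => ⟨hz.mem t ht, mem_univ _⟩
  exact (contDiff_snd.snd.contDiffOn).prodMk (hf.comp contDiff_snd.contDiffOn fun w hw => hw.2)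

theorem IsLocalGeodesic.hasDerivAt {U : Set E} {f : E × E → E} {ε : ℝ} {z : ℝ → E × E}
    (hz : IsLocalGeodesic U f ε z) {t : ℝ} (ht : t ∈ Ioo (-ε) ε) :
    HasDerivAt z ((z t).2, f (z t)) t :=
  (hz.hasDerivWithinAt t (Ioo_subset_Icc_self ht)).hasDerivAt (Icc_mem_nhds ht.1 ht.2)

theorem exists_isLocalGeodesic [CompleteSpace E] {U : Set E} (hU : IsOpen U) {f : E × E → E}
    (hf : ContDiffOn ℝ ∞ f (U ×ˢ univ)) {w : E × E} (hw : w.1 ∈ U) :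
    ∃ ε > 0, ∃ z, IsLocalGeodesic U f ε z ∧ z 0 = w := by
  have hf' : ContDiffAt ℝ 1 (fun w : E × E => (w.2, f w)) w :=
    contDiffAt_snd.prodMk ((hf.contDiffAt ((hU.prod isOpen_univ).mem_nhds
      ⟨hw, mem_univ _⟩)).of_le (by norm_cast))
  obtain ⟨z, hz0, δ, hδ, hz⟩ :=
    hf'.exists_forall_mem_closedBall_exists_eq_forall_mem_Ioo_hasDerivAt₀ 0
  have hc : ContinuousAt (fun t => (z t).1) 0 :=
    (hz 0 ⟨by linarith, by linarith⟩).continuousAt.fst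
  obtain ⟨η, hη, hη'⟩ := Metric.mem_nhds_iff.1
    (hc.preimage_mem_nhds (hU.mem_nhds (by rw [hz0]; exact hw)))
  -- Halving puts the closed interval `[-ε, ε]` inside both open ones; compactness is needed later
  -- for the linearized equations.
  have hε : 0 < min δ η / 2 := by positivity
  have h1 : min δ η / 2 < δ := by linarith [min_le_left δ η]
  have h2 : min δ η / 2 < η := by linarith [min_le_right δ η]
  refine ⟨min δ η / 2, hε, z, ⟨fun t ht => hη' ?_, fun t ht => (hz t ?_).hasDerivWithinAt⟩, hz0⟩
  · rw [Metric.mem_ball, dist_zero_right, Real.norm_eq_abs]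
    exact (abs_le.2 ht).trans_lt h2
  · exact ⟨by linarith [ht.1], by linarith [ht.2]⟩

/-- Every solution of the linearized equation is defined on the whole interval on which the given
solution of the original equation is. -/
theorem IsLocalGeodesic.exists_lift [CompleteSpace E] {U : Set E} (hU : IsOpen U) {f : E × E → E}
    (hf : ContDiffOn ℝ ∞ f (U ×ˢ univ)) {ε : ℝ} (hε : 0 ≤ ε) {z : ℝ → E × E}
    (hz : IsLocalGeodesic U f ε z) {w : (E × E) × (E × E)} (hw : (w.1.1, w.2.1) = z 0) :
    ∃ Z, IsLocalGeodesic {x : E × E | x.1 ∈ U} (localLift f) ε Z ∧ Z 0 = w ∧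
      ∀ t, ((Z t).1.1, (Z t).2.1) = z t := by
  -- The linearization of `(x, v) ↦ (v, f (x, v))` along `z`.
  have hA : ContinuousOn (fun t => (ContinuousLinearMap.snd ℝ E E).prod (fderiv ℝ f (z t)))
      (Icc (-ε) ε) := by
    have h1 : ContinuousOn (fun t => fderiv ℝ f (z t)) (Icc (-ε) ε) :=
      (hf.continuousOn_fderiv_of_isOpen (hU.prod isOpen_univ) (by simp)).comp
        (hz.contDiffOn hf).continuousOn fun t ht => ⟨hz.mem t ht, mem_univ _⟩
    exact (ContinuousLinearMap.prodₗᵢ ℝ).continuous.comp_continuousOn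
      ((continuousOn_const (c := ContinuousLinearMap.snd ℝ E E)).prodMk h1)
  obtain ⟨j, hj0, hj⟩ := exists_solution_linearODE hε hA (w.1.2, w.2.2)
  -- The solution and its variation, reordered as `((x, y), (X, Y))`. The domain condition concerns
  -- `x` alone, so the variation may grow freely.
  refine ⟨fun t => linearFlip E (z t, j t), ⟨hz.mem, fun t ht => ?_⟩, ?_, fun t => rfl⟩
  · exact (linearFlip E).hasFDerivAt.comp_hasDerivWithinAt t
      ((hz.hasDerivWithinAt t ht).prodMk (hj t ht))
  · change linearFlip E (z 0, j 0) = w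
    rw [hj0, ← hw]
    rfl

end LocalGeodesic

/-! ### Geodesics in a chart -/

section Geodesic

variable {E H M : Type*} [NormedAddCommGroup E] [NormedSpace ℝ E] [TopologicalSpace H]
  {I : ModelWithCorners ℝ E H} [TopologicalSpace M] [ChartedSpace H M]

variable (I) in
/-- The curve in `M` with the local expression `z` in the tangent bundle chart at `p`. -/
def chartCurve (p : M) (z : ℝ → E × E) (t : ℝ) : M := (extChartAt I p).symm (z t).1

variable {p : M} {f : E × E → E} {ε : ℝ} {z : ℝ → E × E}

theorem extChartAt_chartCurve (hz : IsLocalGeodesic (extChartAt I p).target f ε z) {t : ℝ}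
    (ht : t ∈ Ioo (-ε) ε) : extChartAt I p (chartCurve I p z t) = (z t).1 :=
  (extChartAt I p).right_inv (hz.mem t (Ioo_subset_Icc_self ht))

theorem chartCurve_mem_source (hz : IsLocalGeodesic (extChartAt I p).target f ε z) {t : ℝ}
    (ht : t ∈ Ioo (-ε) ε) : chartCurve I p z t ∈ (extChartAt I p).source :=
  (extChartAt I p).map_target (hz.mem t (Ioo_subset_Icc_self ht))

variable [IsManifold I ∞ M]
  {S : TangentBundle I M → TangentBundle I.tangent (TangentBundle I M)}

/-- The second order equation on `M` is a first order one on `TM`, which is Hausdorff by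
`tangentBundle_t2Space`, so uniqueness of integral curves applies. -/
theorem IsSmoothField.eqOn_of_curveLift_eq [I.Boundaryless] [T2Space M] (hS : IsSmoothField S) {ε : ℝ}
    {c₁ c₂ : ℝ → TangentBundle I M} (hε : 0 < ε)
    (h₁ : ∀ t ∈ Ioo (-ε) ε, MDifferentiableAt 𝓘(ℝ, ℝ) I.tangent c₁ t ∧
      curveLift I.tangent c₁ t = S (c₁ t))
    (h₂ : ∀ t ∈ Ioo (-ε) ε, MDifferentiableAt 𝓘(ℝ, ℝ) I.tangent c₂ t ∧
      curveLift I.tangent c₂ t = S (c₂ t)) (h0 : c₁ 0 = c₂ 0) : EqOn c₁ c₂ (Ioo (-ε) ε) := by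
  let v : ∀ y : TangentBundle I M, TangentSpace I.tangent y := fun y => ((S y).2 : E × E)
  have hv : (fun y => (⟨y, v y⟩ : TangentBundle I.tangent (TangentBundle I M))) = S :=
    funext fun y => Bundle.TotalSpace.ext (hS.proj y).symm HEq.rfl
  have key : ∀ c : ℝ → TangentBundle I M, (∀ t ∈ Ioo (-ε) ε,
      MDifferentiableAt 𝓘(ℝ, ℝ) I.tangent c t ∧ curveLift I.tangent c t = S (c t)) →
      IsMIntegralCurveOn c v (Ioo (-ε) ε) := fun c hc t ht => by
    have h1 := (hc t ht).1.hasMFDerivAt_curveLift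
    rw [(hc t ht).2] at h1
    exact h1.hasMFDerivWithinAt
  refine isMIntegralCurveOn_Ioo_eqOn_of_contMDiff_boundaryless (I := I.tangent) (v := v) (t₀ := 0)
    ⟨by linarith, hε⟩ ?_ (key c₁ h₁) (key c₂ h₂) h0
  rw [hv]
  exact hS.contMDiff.of_le (by norm_cast)

variable [CompleteSpace E]

theorem contMDiffOn_chartCurve (hf : HasLocalForm S p f)
    (hz : IsLocalGeodesic (extChartAt I p).target f ε z) :
    ContMDiffOn 𝓘(ℝ, ℝ) I ∞ (chartCurve I p z) (Ioo (-ε) ε) :=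
  (contMDiffOn_extChartAt_symm p).comp
    ((hz.contDiffOn hf.contDiffOn).fst.mono Ioo_subset_Icc_self).contMDiffOn
    fun t ht => hz.mem t (Ioo_subset_Icc_self ht)

theorem mdifferentiableAt_chartCurve (hf : HasLocalForm S p f)
    (hz : IsLocalGeodesic (extChartAt I p).target f ε z) {t : ℝ} (ht : t ∈ Ioo (-ε) ε) :
    MDifferentiableAt 𝓘(ℝ, ℝ) I (chartCurve I p z) t :=
  ((contMDiffOn_chartCurve hf hz).contMDiffAt (Ioo_mem_nhds ht.1 ht.2)).mdifferentiableAt (by simp)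

theorem extChartAt_curveLift_chartCurve (hf : HasLocalForm S p f)
    (hz : IsLocalGeodesic (extChartAt I p).target f ε z) {t : ℝ} (ht : t ∈ Ioo (-ε) ε)
    {q : TangentBundle I M} (hq : q.1 = p) :
    extChartAt I.tangent q (curveLift I (chartCurve I p z) t) = z t := by
  subst hq
  refine (extChartAt_curveLift (mdifferentiableAt_chartCurve hf hz ht)
    (chartCurve_mem_source hz ht) (hz.hasDerivAt ht).fst ?_).trans rfl
  filter_upwards [Ioo_mem_nhds ht.1 ht.2] with s hs
  exact extChartAt_chartCurve hz hs

variable [I.Boundaryless]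

theorem mdifferentiableAt_curveLift_chartCurve (hf : HasLocalForm S p f)
    (hz : IsLocalGeodesic (extChartAt I p).target f ε z) {t : ℝ} (ht : t ∈ Ioo (-ε) ε) :
    MDifferentiableAt 𝓘(ℝ, ℝ) I.tangent (curveLift I (chartCurve I p z)) t := by
  let q : TangentBundle I M := ⟨p, (0 : E)⟩
  have h1 : MDifferentiableAt 𝓘(ℝ, E × E) I.tangent (extChartAt I.tangent q).symm (z t) :=
    ((contMDiffOn_extChartAt_symm (I := I.tangent) (n := ∞) q).contMDiffAt
      ((isOpen_extChartAt_target q).mem_nhds (mem_extChartAt_tangent_target.2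
        (hz.mem t (Ioo_subset_Icc_self ht))))).mdifferentiableAt (by simp)
  refine (h1.comp t (hz.hasDerivAt ht).differentiableAt.mdifferentiableAt).congr_of_eventuallyEq ?_
  filter_upwards [Ioo_mem_nhds ht.1 ht.2] with s hs
  have h2 := (extChartAt I.tangent q).left_inv
    (mem_extChartAt_tangent_source.2 (chartCurve_mem_source hz hs) :
      curveLift I (chartCurve I p z) s ∈ _)
  rw [extChartAt_curveLift_chartCurve hf hz hs rfl] at h2
  exact h2.symm

/-- Charts are injective on their domains, so both sides can be compared there: the velocity reads
`z`, and the second velocity reads `(z, z')`. -/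
theorem isGeodesic_chartCurve (hS : IsSmoothField S) (hf : HasLocalForm S p f)
    (hz : IsLocalGeodesic (extChartAt I p).target f ε z) :
    IsGeodesic I S ε (chartCurve I p z) := by
  refine ⟨contMDiffOn_chartCurve hf hz, fun t ht => ?_⟩
  let q : TangentBundle I M := ⟨p, (0 : E)⟩
  let Q : TangentBundle I.tangent (TangentBundle I M) := ⟨q, (0 : E × E)⟩
  have hs : curveLift I (chartCurve I p z) t ∈ (extChartAt I.tangent q).source :=
    mem_extChartAt_tangent_source.2 (chartCurve_mem_source hz ht)
  refine (extChartAt I.tangent.tangent Q).injOn (mem_extChartAt_tangent_source.2 hs)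
    (mem_extChartAt_tangent_source.2 (by rw [hS.proj]; exact hs)) ?_
  rw [hf.apply _ (chartCurve_mem_source hz ht) Q rfl, extChartAt_curveLift_chartCurve hf hz ht rfl]
  refine extChartAt_curveLift (mdifferentiableAt_curveLift_chartCurve hf hz ht) hs
    (hz.hasDerivAt ht) ?_
  filter_upwards [Ioo_mem_nhds ht.1 ht.2] with s hs
  exact extChartAt_curveLift_chartCurve hf hz hs rfl

end Geodesic

/-! ### The iterated tangent bundles -/

/-- Dependent choice with an invariant, for a family of varying types. -/
theorem exists_sequence_of_forall_exists_succ {α : ℕ → Type*} {P : ∀ i, α i → Prop}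
    {R : ∀ i, α i → α (i + 1) → Prop} (h0 : ∃ a, P 0 a)
    (hs : ∀ i a, P i a → ∃ b, P (i + 1) b ∧ R i a b) :
    ∃ s : ∀ i, α i, (∀ i, P i (s i)) ∧ ∀ i, R i (s i) (s (i + 1)) := by
  choose f hf hf' using hs
  obtain ⟨a, ha⟩ := h0
  let s : ∀ i, {a : α i // P i a} := fun i =>
    Nat.rec ⟨a, ha⟩ (fun i b => ⟨f i b.1 b.2, hf i b.1 b.2⟩) i
  exact ⟨fun i => (s i).1, fun i => (s i).2, fun i => hf' i (s i).1 (s i).2⟩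

namespace BanachManifold

variable (M : BanachManifold.{u}) {S : M.tangent → M.tangent.tangent}

theorem isSmoothField_iterLift (hS : IsSmoothField S) (i : ℕ) : IsSmoothField (M.iterLift S i) := by
  induction i with
  | zero => exact hS
  | succ i ih => exact isSmoothField_completeLift ih

theorem t2Space_iterTangent [T2Space M] (i : ℕ) : T2Space (M.iterTangent i) := by
  induction i with
  | zero => assumption
  | succ i ih =>
    have : IsManifold (M.iterTangent i).I 1 (M.iterTangent i) := .of_le (n := ∞) (by norm_cast)
    exact tangentBundle_t2Space

variable {M}

/-- The number `ε` comes from the nonlinear equation at level `0`; each further level solves only a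
linear equation over the curve already found. -/
theorem exists_chart_geodesics (hS : IsSemispray M.I S) (ξ : M.infTangent.tangent.Lim) :
    ∃ ε > 0, ∃ (f : ∀ i, (M.iterTangent i).E × (M.iterTangent i).E → (M.iterTangent i).E)
      (z : ∀ i, ℝ → (M.iterTangent i).E × (M.iterTangent i).E),
      (∀ i, HasLocalForm (M.iterLift S i) (ξ.1 i).1 (f i) ∧
        IsLocalGeodesic (extChartAt (M.iterTangent i).I (ξ.1 i).1).target (f i) ε (z i) ∧
        z i 0 = extChartAt (M.iterTangent i).I.tangent (ξ.1 i) (ξ.1 i)) ∧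
      ∀ i t, (M.infTangent.modelMap i (z (i + 1) t).1, M.infTangent.modelMap i (z (i + 1) t).2) =
        z i t := by
  obtain ⟨f₀, hf₀⟩ : ∃ f, HasLocalForm (M.iterLift S 0) (ξ.1 0).1 f := hS.exists_hasLocalForm _
  obtain ⟨ε, hε, z₀, hz₀, hz₀'⟩ := exists_isLocalGeodesic
    (isOpen_extChartAt_target (I := (M.iterTangent 0).I) (ξ.1 0).1) hf₀.contDiffOn
    (w := extChartAt (M.iterTangent 0).I.tangent (ξ.1 0) (ξ.1 0)) (mem_extChartAt_target _)
  obtain ⟨s, hs, hs'⟩ := exists_sequence_of_forall_exists_succ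
    (α := fun i => ((M.iterTangent i).E × (M.iterTangent i).E → (M.iterTangent i).E) ×
      (ℝ → (M.iterTangent i).E × (M.iterTangent i).E))
    (P := fun i a => HasLocalForm (M.iterLift S i) (ξ.1 i).1 a.1 ∧
        IsLocalGeodesic (extChartAt (M.iterTangent i).I (ξ.1 i).1).target a.1 ε a.2 ∧
        a.2 0 = extChartAt (M.iterTangent i).I.tangent (ξ.1 i) (ξ.1 i))
    (R := fun i a b => ∀ t, (M.infTangent.modelMap i (b.2 t).1, M.infTangent.modelMap i (b.2 t).2) =
        a.2 t) ⟨(f₀, z₀), hf₀, hz₀, hz₀'⟩ (by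
      rintro i ⟨f, z⟩ ⟨hf, hz, hz0⟩
      have hbase : (ξ.1 (i + 1)).1.1 = (ξ.1 i).1 := (M.infTangent.tangentProj ξ).2 i
      have hw : (M.infTangent.modelMap i (extChartAt (M.iterTangent (i + 1)).I.tangent (ξ.1 (i + 1))
            (ξ.1 (i + 1))).1,
          M.infTangent.modelMap i (extChartAt (M.iterTangent (i + 1)).I.tangent (ξ.1 (i + 1))
            (ξ.1 (i + 1))).2) = z 0 := by
        -- Compatibility of `ξ` under `Tπ`, read in charts, says that the new initial value lies
        -- over the old one.
        have := M.infTangent.tangent.chart_map i (ξ.1 (i + 1)) (ξ.1 (i + 1))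
          (mem_extChartAt_source _)
        rw [ξ.2 i] at this
        exact this.symm.trans hz0.symm
      obtain ⟨Z, hZ, hZ0, hZz⟩ := hz.exists_lift (isOpen_extChartAt_target (ξ.1 i).1) hf.contDiffOn
        hε.le (w := extChartAt (M.iterTangent (i + 1)).I.tangent (ξ.1 (i + 1)) (ξ.1 (i + 1))) hw
      refine ⟨(localLift f, Z), ⟨hasLocalForm_completeLift
        (M.isSmoothField_iterLift hS.isSmoothField i) hf hbase, ?_, hZ0⟩, hZz⟩
      refine ⟨fun t ht => ?_, hZ.hasDerivWithinAt⟩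
      have h1 := hZ.mem t ht
      refine (mem_extChartAt_tangent_target (I := (M.iterTangent i).I)
        (p := (ξ.1 (i + 1)).1)).2 ?_
      rw [hbase]
      exact h1)
  exact ⟨ε, hε, fun i => (s i).1, fun i => (s i).2, hs, hs'⟩

end BanachManifold

/-! ### Existence and uniqueness of geodesics in the limit -/

namespace BanachManifold

variable {M : BanachManifold.{u}} {S : M.tangent → M.tangent.tangent}

theorem exists_isGeodesic_infLift (hS : IsSemispray M.I S) (ξ : M.infTangent.tangent.Lim) :
    ∃ ε > 0, ∃ γ : ℝ → M.infTangent.Lim,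
      M.infTangent.IsGeodesic (M.infLift S) ε γ ∧
      γ 0 = M.infTangent.tangentProj ξ ∧ M.infTangent.HasVelocityAt γ ξ 0 ∧
      ∀ i, IsGeodesic (M.iterTangent i).I (M.iterLift S i) ε (fun t => (γ t).1 i) := by
  obtain ⟨ε, hε, f, z, hfz, hzz⟩ := exists_chart_geodesics hS ξ
  have h0 : (0 : ℝ) ∈ Ioo (-ε) ε := ⟨by linarith, hε⟩
  let g : ∀ i, ℝ → M.iterTangent i := fun i => chartCurve (M.iterTangent i).I (ξ.1 i).1 (z i)
  -- This holds for every real `t`, since the coordinate curves project to each other everywhere; so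
  -- `γ` takes values in the limit without a case distinction.
  have hg : ∀ i t, M.infTangent.map i (g (i + 1) t) = g i t := fun i t => by
    have hbase : (ξ.1 (i + 1)).1.1 = (ξ.1 i).1 := (M.infTangent.tangentProj ξ).2 i
    have h1 : M.infTangent.map i (g (i + 1) t) =
        (extChartAt (M.iterTangent i).I (ξ.1 (i + 1)).1.1).symm
          (M.infTangent.modelMap i (z (i + 1) t).1) := rfl
    rw [h1, hbase]
    exact congrArg (fun w => (extChartAt (M.iterTangent i).I (ξ.1 i).1).symm w.1) (hzz i t)
  have hgeo : ∀ i, IsGeodesic (M.iterTangent i).I (M.iterLift S i) ε (g i) := fun i =>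
    isGeodesic_chartCurve (M.isSmoothField_iterLift hS.isSmoothField i) (hfz i).1 (hfz i).2.1
  have hgd : ∀ i, ∀ t ∈ Ioo (-ε) ε, MDifferentiableAt 𝓘(ℝ, ℝ) (M.iterTangent i).I (g i) t :=
    fun i t ht => mdifferentiableAt_chartCurve (hfz i).1 (hfz i).2.1 ht
  have hgdd : ∀ i, ∀ t ∈ Ioo (-ε) ε, MDifferentiableAt 𝓘(ℝ, ℝ) (M.iterTangent i).I.tangent
      (curveLift (M.iterTangent i).I (g i)) t :=
    fun i t ht => mdifferentiableAt_curveLift_chartCurve (hfz i).1 (hfz i).2.1 ht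
  have hg0 : ∀ i, curveLift (M.iterTangent i).I (g i) 0 = ξ.1 i := fun i => by
    refine (extChartAt (M.iterTangent i).I.tangent (ξ.1 i)).injOn
      (mem_extChartAt_tangent_source.2 (chartCurve_mem_source (hfz i).2.1 h0))
      (mem_extChartAt_source _) ?_
    rw [← (hfz i).2.2]
    exact extChartAt_curveLift_chartCurve (hfz i).1 (hfz i).2.1 h0 rfl
  let γ : ℝ → M.infTangent.Lim := fun t => ⟨fun i => g i t, fun i => hg i t⟩
  -- The chain rule for `π ∘ g (i + 1) = g i`.
  have hlift : ∀ t ∈ Ioo (-ε) ε, ∀ i, M.infTangent.tangent.map i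
      (curveLift (M.iterTangent (i + 1)).I (g (i + 1)) t) =
        curveLift (M.iterTangent i).I (g i) t := fun t ht i => by
    have h1 : M.infTangent.map i ∘ g (i + 1) = g i := funext (hg i)
    have h2 := tangentMap_comp_at (⟨t, (1 : ℝ)⟩ : TangentBundle 𝓘(ℝ, ℝ) ℝ)
      ((M.infTangent.contMDiff_map i).mdifferentiable (by simp) (g (i + 1) t)) (hgd (i + 1) t ht)
    rw [h1] at h2
    exact h2.symm
  classical
  -- Outside the interval differentiability is not available, so the velocities need not be
  -- compatible; `ξ` is a default value there.
  let γ' : ℝ → M.infTangent.tangent.Lim := fun t =>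
    if ht : t ∈ Ioo (-ε) ε then
      ⟨fun i => curveLift (M.iterTangent i).I (g i) t, hlift t ht⟩ else ξ
  have hγ' : ∀ t ∈ Ioo (-ε) ε, ∀ i, (γ' t).1 i = curveLift (M.iterTangent i).I (g i) t :=
    fun t ht i => by simp only [γ', dif_pos ht]
  have hvel : M.infTangent.HasVelocityAt γ ξ 0 :=
    ProjSystem.hasVelocityAt_iff.2 fun i => ⟨hgd i 0 h0, hg0 i⟩
  refine ⟨ε, hε, γ, ⟨fun t ht => ?_, γ', fun t ht => ⟨?_, ?_⟩⟩, hvel.1.symm, hvel, hgeo⟩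
  · exact ProjSystem.smoothCurveAt_of_contMDiffOn (Ioo_mem_nhds ht.1 ht.2)
      fun i => (hgeo i).contMDiffOn
  · exact ProjSystem.hasVelocityAt_iff.2 fun i => ⟨hgd i t ht, (hγ' t ht i).symm⟩
  · refine ProjSystem.hasVelocityAt_iff.2 fun i => ?_
    have hev : (fun s => (γ' s).1 i) =ᶠ[𝓝 t] curveLift (M.iterTangent i).I (g i) := by
      filter_upwards [Ioo_mem_nhds ht.1 ht.2] with s hs
      exact hγ' s hs i
    refine ⟨(hgdd i t ht).congr_of_eventuallyEq hev, ?_⟩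
    refine (curveLift_congr hev).trans (((hgeo i).curveLift_curveLift t ht).trans ?_)
    exact congrArg (M.iterLift S i) (hγ' t ht i).symm

theorem eq_of_isGeodesic_infLift [T2Space M] (hS : IsSmoothField S)
    {ξ : M.infTangent.tangent.Lim} {ε₁ ε₂ : ℝ} (hε₁ : 0 < ε₁) (hε₂ : 0 < ε₂)
    {γ₁ γ₂ : ℝ → M.infTangent.Lim} (h₁ : M.infTangent.IsGeodesic (M.infLift S) ε₁ γ₁)
    (hξ₁ : M.infTangent.HasVelocityAt γ₁ ξ 0) (h₂ : M.infTangent.IsGeodesic (M.infLift S) ε₂ γ₂)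
    (hξ₂ : M.infTangent.HasVelocityAt γ₂ ξ 0) {t : ℝ} (ht : |t| < min ε₁ ε₂) : γ₁ t = γ₂ t := by
  -- Both velocity curves are restricted to the common interval. They start at `ξ` because the
  -- velocity of a curve is determined by the curve.
  have key : ∀ ε ≥ min ε₁ ε₂, ∀ γ, M.infTangent.IsGeodesic (M.infLift S) ε γ →
      M.infTangent.HasVelocityAt γ ξ 0 → ∃ γ' : ℝ → M.infTangent.tangent.Lim, γ' 0 = ξ ∧
        ∀ t ∈ Ioo (-min ε₁ ε₂) (min ε₁ ε₂), M.infTangent.tangentProj (γ' t) = γ t ∧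
          ∀ i, MDifferentiableAt 𝓘(ℝ, ℝ) (M.iterTangent i).I.tangent (fun s => (γ' s).1 i) t ∧
            curveLift (M.iterTangent i).I.tangent (fun s => (γ' s).1 i) t =
              M.iterLift S i ((γ' t).1 i) := by
    intro ε hε γ hγ hξ
    have hε0 : 0 < ε := (lt_min hε₁ hε₂).trans_le hε
    obtain ⟨γ', hγ'⟩ := hγ.hasVelocityAt
    refine ⟨γ', Subtype.ext (funext fun i => ?_), fun t ht => ?_⟩
    · exact (ProjSystem.hasVelocityAt_iff.1 (hγ' 0 ⟨by linarith, hε0⟩).1 i).2.symm.trans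
        (ProjSystem.hasVelocityAt_iff.1 hξ i).2
    · have := hγ' t ⟨by linarith [ht.1], by linarith [ht.2]⟩
      exact ⟨this.1.1, fun i => ProjSystem.hasVelocityAt_iff.1 this.2 i⟩
  obtain ⟨c₁, hc₁, hc₁'⟩ := key ε₁ (min_le_left _ _) γ₁ h₁ hξ₁
  obtain ⟨c₂, hc₂, hc₂'⟩ := key ε₂ (min_le_right _ _) γ₂ h₂ hξ₂
  have ht' : t ∈ Ioo (-min ε₁ ε₂) (min ε₁ ε₂) := abs_lt.1 ht
  have hc : c₁ t = c₂ t := Subtype.ext (funext fun i => by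
    have := M.t2Space_iterTangent i
    exact (M.isSmoothField_iterLift hS i).eqOn_of_curveLift_eq (lt_min hε₁ hε₂)
      (fun s hs => (hc₁' s hs).2 i) (fun s hs => (hc₂' s hs).2 i) (by rw [hc₁, hc₂]) ht')
  rw [← (hc₁' t ht').1, ← (hc₂' t ht').1, hc]

end BanachManifold

end

theorem mainTheorem4 (M : BanachManifold.{u}) [T2Space M]
    (S : M.tangent → M.tangent.tangent) (hS : IsSemispray M.I S)
    (x : M.infTangent.Lim) (ξ : M.infTangent.tangent.Lim) (hξ : M.infTangent.tangentProj ξ = x) :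
    (∃ ε > 0, ∃ γ : ℝ → M.infTangent.Lim,
      M.infTangent.IsGeodesic (M.infLift S) ε γ ∧
      γ 0 = x ∧ M.infTangent.HasVelocityAt γ ξ 0 ∧
      ∃ g : ∀ i, ℝ → M.iterTangent i,
        (∀ i, IsGeodesic (M.iterTangent i).I (M.iterLift S i) ε (g i) ∧
          g i 0 = x.1 i ∧ curveLift (M.iterTangent i).I (g i) 0 = ξ.1 i) ∧
        ∀ t ∈ Set.Ioo (-ε) ε, ∀ i,
          M.infTangent.map i (g (i + 1) t) = g i t ∧ (γ t).1 i = g i t) ∧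
    (∀ ε₁ > 0, ∀ ε₂ > 0, ∀ γ₁ γ₂ : ℝ → M.infTangent.Lim,
      M.infTangent.IsGeodesic (M.infLift S) ε₁ γ₁ →
      γ₁ 0 = x → M.infTangent.HasVelocityAt γ₁ ξ 0 →
      M.infTangent.IsGeodesic (M.infLift S) ε₂ γ₂ →
      γ₂ 0 = x → M.infTangent.HasVelocityAt γ₂ ξ 0 →
      ∀ t, |t| < min ε₁ ε₂ → γ₁ t = γ₂ t) := by
  refine ⟨?_, fun ε₁ hε₁ ε₂ hε₂ γ₁ γ₂ h₁ _ hξ₁ h₂ _ hξ₂ t ht =>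
    BanachManifold.eq_of_isGeodesic_infLift hS.isSmoothField hε₁ hε₂ h₁ hξ₁ h₂ hξ₂ ht⟩
  obtain ⟨ε, hε, γ, hγ, hγ0, hγξ, hgeo⟩ := BanachManifold.exists_isGeodesic_infLift hS ξ
  refine ⟨ε, hε, γ, hγ, hγ0.trans hξ, hγξ, fun i t => (γ t).1 i, fun i => ⟨hgeo i, ?_, ?_⟩,
    fun t _ i => ⟨(γ t).2 i, rfl⟩⟩
  · exact congrArg (fun y : M.infTangent.Lim => y.1 i) (hγ0.trans hξ)
  · exact (ProjSystem.hasVelocityAt_iff.1 hγξ i).2
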